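/- **Setting.** Let $n\ge 1$, let $Q$ and $U_0,\dots,U_{n-1}$ be finite-dimensional smooth manifolds (Hausdorff, without boundary, not necessarily of the same dimension), let each $U_i$ carry a Riemannian metric $g_i$, let $\mathbb U_i\subseteq U_i$ be closed sets, and let $F_i:Q\times U_i\to Q$ be $C^1$ maps. Put $\mathcal U=\{\mathbf u\in\prod_i U_i: u_i\in\mathbb U_i \text{ for } 0\le i\le n-1\}$ and equip $\prod_i U_i$ with the product metric $g(\mathbf v,\mathbf w)=\sum_i g_i(v_i,w_i)$. Let $\ell:Q\to\mathbb R$ and $L_i:Q\times U_i\to\mathbb R$ be locally Lipschitz (every point has a smooth chart around it in which the function is Lipschitz). Fix $q_0\in Q$; for $\mathbf u\in\prod_i U_i$ let $q_i=F_{i-1}(q_{i-1},u_{i-1})$ $(1\le i\le n)$ and $$J(\mathbf u)=\ell(q_n)+\sum_{i=0}^{n-1}L_i(q_i,u_i).$$ **Definitions.** Let $M$ be a smooth manifold and $f:M\to\mathbb R\cup\{\infty\}$ lower semicontinuous. * $p\in T_q^*M$ is a Fréchet subgradient of $f$ at $q$ ($p\in\partial_F f(q)$) if $f(q)<\infty$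 and there is a $C^1$ function $h:M\to\mathbb R$ such that $p=dh(q)$ and $f-h$ has a local minimum at $q$. * $p\in T_q^*M$ is a limiting subgradient of $f$ at $q$ ($p\in\partial_L f(q)$) if there are sequences $x_k\to q$ and $p_k\in\partial_F f(x_k)$ with $f(x_k)\to f(q)$ and $p_k\to p$ in $T^*M$. For a function $f(q,u)$, $\partial_{L,u}f(q,u)$ is the limiting subdifferential of $u\mapsto f(q,u)$. * For a closed set $S\subseteq M$ and $s\in S$, let $\chi_S$ be $0$ on $S$ and $\infty$ off $S$. The limiting normal cone is $N_S^L(s)=\partial_L\chi_S(s)$, and the Clarke tangent cone is $T_S^C(s)=\{v\in T_sM:\langle p,v\rangle\le 0\ \text{for all } p\in N_S^L(s)\}$. * For $f:M\to\mathbb R$ locally Lipschitz and $v\in T_qM$, the lower Dini derivative is $\underline Df(q;v)=\liminf_{\lambda\downarrow0}\frac{f(c(\lambda))-f(q)}{\lambda}$, where $c:\mathbb R\to M$ is any smooth curve with $c(0)=q$, $c'(0)=v$. * For $\Delta\ge0$, a control sequence $\mathbf u\in\mathcal U$ is $\Delta$-critical for $J$ if $-\Delta\|\mathbf v\|_g\le\underline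 DJ(\mathbf u;\mathbf v)$ for all $\mathbf v\in T^C_{\mathcal U}(\mathbf u)$. **Theorem.** If $\mathbf u\in\mathcal U$ is $\Delta$-critical for $J$, with state sequence $(q_i)_{i=0}^n$, then there exist covectors $a_i\in T^*_{q_i}Q$ $(1\le i\le n)$ and $b_i\in T^*_{u_i}U_i$ $(0\le i\le n-1)$ with $$a_n\in\partial_L\ell(q_n),\qquad b_0\in\partial_{L,u}L_0(q_0,u_0),\qquad (a_i,b_i)\in\partial_L L_i(q_i,u_i)\quad(1\le i\le n-1),$$ such that the costates $p_i\in T^*_{q_i}Q$ $(1\le i\le n)$ determined by $$-p_n=a_n,\qquad p_{i-1}=-a_{i-1}+D_qF_{i-1}(q_{i-1},u_{i-1})^*p_i\quad(2\le i\le n)$$ satisfy, for every $0\le i\le n-1$ and every $v\in T^C_{\mathbb U_i}(u_i)$, $$-\Delta\|v\|_{g_i}\le\langle b_i-D_uF_i(q_i,u_i)^*p_{i+1},\,v\rangle .$$ -/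

import Mathlib

open Set Filter Topology Bundle Manifold
open scoped ContDiff

noncomputable section

namespace GeometricControl

section NonsmoothAnalysis

variable {E : Type*} [NormedAddCommGroup E] [NormedSpace ℝ E]
  {H : Type*} [TopologicalSpace H] (I : ModelWithCorners ℝ E H)
  {M : Type*} [TopologicalSpace M] [ChartedSpace H M]

/-- The cotangent space `T_q^* M`. -/
abbrev Cotangent (q : M) : Type _ := TangentSpace I q →L[ℝ] ℝ

/-- The total space `T^* M` of the cotangent bundle, with Mathlib's topology on the bundle of
continuous linear maps from the tangent bundle to the trivial line bundle. -/
abbrev CotangentBundle (M : Type*) [TopologicalSpace M] [ChartedSpace H M] : Type _ :=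
  TotalSpace (E →L[ℝ] ℝ) (fun q : M => TangentSpace I q →L[ℝ] Bundle.Trivial M ℝ q)

/-- `f` is locally Lipschitz on `M`: around every point there is a smooth chart in which `f`
is Lipschitz. -/
def IsLocallyLipschitz (f : M → ℝ) : Prop :=
  ∀ q : M, ∃ φ ∈ IsManifold.maximalAtlas I ∞ M, q ∈ φ.source ∧
    ∃ K : NNReal, LipschitzOnWith K (f ∘ (φ.extend I).symm) (φ.extend I).target

/-- `c : ℝ → M` is a smooth curve with `c 0 = q` and `c' 0 = v`. -/
def IsSmoothCurveThrough (c : ℝ → M) (q : M) (v : TangentSpace I q) : Prop :=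
  ContMDiff 𝓘(ℝ, ℝ) I ∞ c ∧
    (⟨c 0, mfderiv 𝓘(ℝ, ℝ) I c 0 (1 : ℝ)⟩ : TangentBundle I M) = ⟨q, v⟩

/-- The lower Dini derivative `liminf_{t ↓ 0} (f (c t) - f q) / t`, where `c` is a smooth curve with
`c 0 = q`, `c' 0 = v`. For a locally Lipschitz function the lower limit does not depend on the
curve; the infimum over all curves makes the definition independent of a choice. -/
def lowerDini (f : M → ℝ) (q : M) (v : TangentSpace I q) : EReal :=
  ⨅ (c : ℝ → M) (_ : IsSmoothCurveThrough I c q v),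
    liminf (fun t : ℝ => (((f (c t) - f q) / t : ℝ) : EReal)) (𝓝[>] 0)

/-- The Fréchet subdifferential of `f : M → ℝ ∪ {∞}` at `q`: the differentials at `q` of the `C^1`
functions `g : M → ℝ` for which `f - g` has a local minimum at `q`, where `f q` is finite. -/
def frechetSubdiff (f : M → EReal) (q : M) : Set (Cotangent I q) :=
  {p | f q ≠ ⊤ ∧ ∃ g : M → ℝ, ContMDiff I 𝓘(ℝ, ℝ) 1 g ∧ p = mfderiv I 𝓘(ℝ, ℝ) g q ∧
    IsLocalMin (fun x => f x - (g x : EReal)) q}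

/-- The limiting subdifferential of `f : M → ℝ ∪ {∞}` at `q`. The covectors `p k` at `x k` converge
to `p` in the cotangent bundle. -/
def limitingSubdiff [IsManifold I 1 M] (f : M → EReal) (q : M) : Set (Cotangent I q) :=
  {p | ∃ (x : ℕ → M) (pk : ∀ k, Cotangent I (x k)),
    (∀ k, pk k ∈ frechetSubdiff I f (x k)) ∧
    Tendsto x atTop (𝓝 q) ∧
    Tendsto (fun k => f (x k)) atTop (𝓝 (f q)) ∧
    Tendsto (fun k => (⟨x k, pk k⟩ : CotangentBundle I M)) atTop (𝓝 ⟨q, p⟩)}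

/-- The indicator function in the sense of variational analysis: `0` on `S`, `∞` off `S`. -/
def indicatorTop (S : Set M) (x : M) : EReal :=
  open scoped Classical in if x ∈ S then 0 else ⊤

/-- The limiting normal cone to `S` at `s ∈ S`. -/
def limitingNormalCone [IsManifold I 1 M] (S : Set M) (s : M) : Set (Cotangent I s) :=
  limitingSubdiff I (indicatorTop S) s

/-- The Clarke tangent cone to `S` at `s ∈ S`, the polar of the limiting normal cone. -/
def clarkeTangentCone [IsManifold I 1 M] (S : Set M) (s : M) : Set (TangentSpace I s) :=
  {v | ∀ p ∈ limitingNormalCone I S s, p v ≤ 0}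

end NonsmoothAnalysis

section ProductCovector

variable {E E' H H' : Type*} [NormedAddCommGroup E] [NormedSpace ℝ E]
  [NormedAddCommGroup E'] [NormedSpace ℝ E'] [TopologicalSpace H] [TopologicalSpace H']
  {I : ModelWithCorners ℝ E H} {I' : ModelWithCorners ℝ E' H'}
  {M M' : Type*} [TopologicalSpace M] [ChartedSpace H M] [TopologicalSpace M'] [ChartedSpace H' M']

/-- The covector `(a, b)` on `M × M'` at `(q, u)`, that is `(w, v) ↦ ⟨a, w⟩ + ⟨b, v⟩`. -/
def prodCovector {q : M} {u : M'} (a : Cotangent I q) (b : Cotangent I' u) :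
    Cotangent (I.prod I') ((q, u) : M × M') :=
  ContinuousLinearMap.coprod (M₁ := E) (M₂ := E') a b

end ProductCovector

section ProductManifold

variable {ι : Type*} [Fintype ι] {V : ι → Type*} [∀ i, NormedAddCommGroup (V i)]
  [∀ i, NormedSpace ℝ (V i)]
  {U : ι → Type*} [∀ i, TopologicalSpace (U i)] [∀ i, ChartedSpace (V i) (U i)]

/-- The model of the product manifold `∏ i, U i`. -/
abbrev piModel (V : ι → Type*) [∀ i, NormedAddCommGroup (V i)] [∀ i, NormedSpace ℝ (V i)] :
    ModelWithCorners ℝ (∀ i, V i) (ModelPi V) :=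
  ModelWithCorners.pi fun i => 𝓘(ℝ, V i)

instance isManifold_pi (m : WithTop ℕ∞) [∀ i, IsManifold 𝓘(ℝ, V i) m (U i)] :
    IsManifold (piModel V) m (∀ i, U i) := by
  refine isManifold_of_contDiffOn (piModel V) m _ ?_
  rintro _ _ ⟨e, he, rfl⟩ ⟨e', he', rfl⟩
  rw [contDiffOn_pi]
  intro i
  have h := (contDiffGroupoid m 𝓘(ℝ, V i)).compatible (he i (mem_univ i)) (he' i (mem_univ i))
  rw [contDiffGroupoid, mem_groupoid_of_pregroupoid] at h
  have h1 : ContDiffOn ℝ m ((e i).symm ≫ₕ e' i) ((e i).symm ≫ₕ e' i).source := by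
    simpa [contDiffPregroupoid] using h.1
  have hp : ContDiffOn ℝ m (fun x : ∀ j, V j => x i)
      ((piModel V).symm ⁻¹' ((OpenPartialHomeomorph.pi e).symm ≫ₕ
        OpenPartialHomeomorph.pi e').source ∩ range (piModel V)) :=
    (ContinuousLinearMap.proj (R := ℝ) (φ := V) i).contDiff.contDiffOn
  refine h1.comp hp ?_
  rintro x ⟨⟨hx, hx'⟩, -⟩
  exact ⟨hx i (mem_univ i), hx' i (mem_univ i)⟩

/-- The component `v i ∈ T_{u i} (U i)` of a tangent vector `v` of the product manifold at `u`. -/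
def component {u : ∀ i, U i} (v : TangentSpace (piModel V) u) (i : ι) :
    TangentSpace 𝓘(ℝ, V i) (u i) :=
  (show ∀ i, V i from v) i

end ProductManifold

section Riemannian

/-- A smooth Riemannian metric on a manifold modelled on `V`. -/
abbrev SmoothMetric (V : Type*) [NormedAddCommGroup V] [NormedSpace ℝ V]
    (U : Type*) [TopologicalSpace U] [ChartedSpace V U] [IsManifold 𝓘(ℝ, V) ∞ U] : Type _ :=
  ContMDiffRiemannianMetric 𝓘(ℝ, V) ∞ V (fun x : U => TangentSpace 𝓘(ℝ, V) x)

/-- The norm `‖v‖_g = g(v, v)^{1/2}` of a tangent vector. -/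
def metricNorm {V : Type*} [NormedAddCommGroup V] [NormedSpace ℝ V]
    {U : Type*} [TopologicalSpace U] [ChartedSpace V U] [IsManifold 𝓘(ℝ, V) ∞ U]
    (g : SmoothMetric V U) {u : U} (v : TangentSpace 𝓘(ℝ, V) u) : ℝ :=
  √(g.inner u v v)

variable {ι : Type*} [Fintype ι] {V : ι → Type*} [∀ i, NormedAddCommGroup (V i)]
  [∀ i, NormedSpace ℝ (V i)]
  {U : ι → Type*} [∀ i, TopologicalSpace (U i)] [∀ i, ChartedSpace (V i) (U i)]
  [∀ i, IsManifold 𝓘(ℝ, V i) ∞ (U i)]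

/-- The norm `‖v‖_g` of a tangent vector of `∏ i, U i` for the product metric
`g(v, w) = ∑ i, g_i(v_i, w_i)`. -/
def productNorm (g : ∀ i, SmoothMetric (V i) (U i)) {u : ∀ i, U i}
    (v : TangentSpace (piModel V) u) : ℝ :=
  √(∑ i, (g i).inner (u i) (component v i) (component v i))

/-- `u` is `Δ`-critical for `J` relative to the control sets `C i ⊆ U i`. -/
def IsCritical (g : ∀ i, SmoothMetric (V i) (U i)) (C : ∀ i, Set (U i)) (J : (∀ i, U i) → ℝ)
    (Δ : ℝ) (u : ∀ i, U i) : Prop :=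
  0 ≤ Δ ∧ ∀ v ∈ clarkeTangentCone (piModel V) {w : ∀ i, U i | ∀ i, w i ∈ C i} u,
    ((-(Δ * productNorm g v) : ℝ) : EReal) ≤ lowerDini (piModel V) J u v

end Riemannian

section ControlSystem

variable {n : ℕ} {Q : Type*} {U : Fin n → Type*}

/-- The state sequence: `q_0` is given and `q_{i+1} = F_i (q_i, u_i)`. -/
def stateSeq (F : ∀ i, Q × U i → Q) (q₀ : Q) (u : ∀ i, U i) (j : Fin (n + 1)) : Q :=
  Fin.induction (motive := fun _ => Q) q₀ (fun i q => F i (q, u i)) j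

/-- The cost `J(u) = ℓ(q_n) + ∑_{i < n} L_i(q_i, u_i)` for the fixed initial state `q₀`. -/
def cost (F : ∀ i, Q × U i → Q) (ℓ : Q → ℝ) (L : ∀ i, Q × U i → ℝ) (q₀ : Q)
    (u : ∀ i, U i) : ℝ :=
  ℓ (stateSeq F q₀ u (Fin.last n)) + ∑ i, L i (stateSeq F q₀ u i.castSucc, u i)

variable {E : Type*} [NormedAddCommGroup E] [NormedSpace ℝ E] [TopologicalSpace Q]
  [ChartedSpace E Q]
  {V : Fin n → Type*} [∀ i, NormedAddCommGroup (V i)] [∀ i, NormedSpace ℝ (V i)]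
  [∀ i, TopologicalSpace (U i)] [∀ i, ChartedSpace (V i) (U i)]

/-- The partial derivative `D_q F_i(q_i, u_i) : T_{q_i} Q → T_{q_{i+1}} Q`, where
`q_{i+1} = F_i(q_i, u_i)` holds by definition. -/
def partialState (F : ∀ i, Q × U i → Q) (q₀ : Q) (u : ∀ i, U i) (i : Fin n) :
    TangentSpace 𝓘(ℝ, E) (stateSeq F q₀ u i.castSucc) →L[ℝ]
      TangentSpace 𝓘(ℝ, E) (stateSeq F q₀ u i.succ) :=
  mfderiv 𝓘(ℝ, E) 𝓘(ℝ, E) (fun r : Q => F i (r, u i)) (stateSeq F q₀ u i.castSucc)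

/-- The partial derivative `D_u F_i(q_i, u_i) : T_{u_i} U_i → T_{q_{i+1}} Q`. -/
def partialControl (F : ∀ i, Q × U i → Q) (q₀ : Q) (u : ∀ i, U i) (i : Fin n) :
    TangentSpace 𝓘(ℝ, V i) (u i) →L[ℝ] TangentSpace 𝓘(ℝ, E) (stateSeq F q₀ u i.succ) :=
  mfderiv 𝓘(ℝ, V i) 𝓘(ℝ, E) (fun c : U i => F i (stateSeq F q₀ u i.castSucc, c)) (u i)

end ControlSystem

end GeometricControl

end

/-! The cost is decoupled from the dynamics. In charts, `chartCost` is a separable function `f` of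
independent variables: the final state, and one pair (state, control) per stage. The dynamics enter
only through the curve-wise derivative `A = stageLin` of the trajectory with respect to the
controls. Since `f` is Lipschitz near the trajectory `y`, criticality becomes a bound along straight
lines: `f` decreases in direction `A w` at rate at most `ψ w = Δ‖w‖_g`, for `w` in the closed convex
cone `K`, the product of the Clarke tangent cones of the factors.

The analytic core is `exists_limitingSubgradient_of_directional`: one limiting subgradient `ξ` of
`f` at `y` satisfies `0 ≤ ψ w + ξ (A w)` for all `w ∈ K` simultaneously. It comes from minimizing `f
z + ψ v + ε‖v‖ + N‖T (z - y - A v)‖²` over `v ∈ K` and `z`, both in small balls. Stationarity in `z`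
makes the derivative of the penalty, up to sign, a Fréchet subgradient of `f`; stationarity in `v`
gives the inequality with error `ε‖w‖` for that same covector. The Lipschitz constant bounds these
covectors independently of `ε`, so a subsequence converges as `ε → 0`. No separation or minimax
argument is needed, and nothing is convexified.

Because `f` is separable, restricting `ξ` to a block gives a limiting subgradient of the
corresponding term (`IsLimitingSubgradient.slice`); these blocks are the `a_i` and `b_i`. The
costate recursion and summation by parts (`sum_costate`) turn `ξ (A w)` into `∑ (b_i w_i - p_{i+1}
D_uF_i w_i)`, and testing with a `w` supported in one stage gives the conclusion. -/

noncomputable section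

namespace GeometricControl

/-! ### Subgradients and the multiplier rule in normed spaces. -/

section VectorSpace

variable {X Y Z : Type*} [NormedAddCommGroup X] [NormedSpace ℝ X]
  [NormedAddCommGroup Y] [NormedSpace ℝ Y] [NormedAddCommGroup Z] [NormedSpace ℝ Z]

/-- `ξ` is a Fréchet subgradient at `z` of a function on a normed space, witnessed by a function
that is `C^1` near `z`. -/
def IsFrechetSubgradient (f : Z → EReal) (z : Z) (ξ : Z →L[ℝ] ℝ) : Prop :=
  f z ≠ ⊤ ∧ ∃ h : Z → ℝ, ContDiffAt ℝ 1 h z ∧ fderiv ℝ h z = ξ ∧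
    IsLocalMin (fun x => f x - (h x : EReal)) z

/-- `ξ` is a limiting subgradient at `y` of a function on a normed space. -/
def IsLimitingSubgradient (f : Z → EReal) (y : Z) (ξ : Z →L[ℝ] ℝ) : Prop :=
  ∃ (z : ℕ → Z) (ξk : ℕ → Z →L[ℝ] ℝ), (∀ k, IsFrechetSubgradient f (z k) (ξk k)) ∧
    Tendsto z atTop (𝓝 y) ∧ Tendsto (fun k => f (z k)) atTop (𝓝 (f y)) ∧
    Tendsto ξk atTop (𝓝 ξ)

/-- A test function for `f` at `z`, pulled back along the affine map `y' ↦ z + j (y' - pr z)`, is a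
test function for `g`. An inequality that is an equality at the base point suffices, which covers
indicator functions as well as separable sums. -/
theorem IsFrechetSubgradient.slice {f : Z → EReal} {g : Y → EReal} (j : Y →L[ℝ] Z)
    (pr : Z →L[ℝ] Y) {z : Z} {ξ : Z →L[ℝ] ℝ} (h : IsFrechetSubgradient f z ξ) (c : ℝ)
    (hz : f z = g (pr z) + c)
    (hle : ∀ᶠ w in 𝓝 (0 : Y), f (z + j w) ≤ g (pr z + w) + c) :
    IsFrechetSubgradient g (pr z) (ξ.comp j) := by
  obtain ⟨hf, h, hc, rfl, hmin⟩ := h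
  have hshift : Tendsto (fun y' : Y => y' - pr z) (𝓝 (pr z)) (𝓝 0) := by
    have : Continuous fun y' : Y => y' - pr z := by fun_prop
    simpa using this.tendsto (pr z)
  have hmap : Tendsto (fun y' : Y => z + j (y' - pr z)) (𝓝 (pr z)) (𝓝 z) := by
    have : Continuous fun y' : Y => z + j (y' - pr z) := by fun_prop
    simpa using this.tendsto (pr z)
  refine ⟨?_, fun y' => h (z + j (y' - pr z)), ?_, ?_, ?_⟩
  · intro ht
    rw [hz, ht, EReal.top_add_coe] at hf
    exact hf rfl
  · have hc' : ContDiffAt ℝ 1 h (z + j (pr z - pr z)) := by simpa using hc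
    have hd : ContDiffAt ℝ 1 (fun y' : Y => z + j (y' - pr z)) (pr z) := by fun_prop
    exact hc'.comp (pr z) hd
  · have hd : HasFDerivAt (fun y' : Y => z + j (y' - pr z)) j (pr z) :=
      (j.hasFDerivAt.comp (pr z) ((hasFDerivAt_id (pr z)).sub_const (pr z))).const_add z
    have hc' : HasFDerivAt h (fderiv ℝ h z) (z + j (pr z - pr z)) := by
      simpa using (hc.differentiableAt one_ne_zero).hasFDerivAt
    exact (hc'.comp (pr z) hd).fderiv
  · filter_upwards [hshift.eventually hle, hmap.eventually hmin] with y' h1 h2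
    simp only [sub_self, map_zero, add_zero]
    rw [add_sub_cancel] at h1
    rw [hz] at h2
    generalize g (pr z) = a at *
    generalize g y' = b at *
    generalize f (z + j (y' - pr z)) = d at *
    generalize h z = s at *
    generalize h (z + j (y' - pr z)) = t at *
    -- The constant `c` and the test values cancel only among finite values, so infinite values of
    -- `g` are treated separately.
    induction b with
    | top => simp
    | bot =>
      have : d = ⊥ := by simpa using h1
      subst this
      induction a with
      | bot => simp
      | top => simp at h2
      | coe a =>
        exfalso
        rw [EReal.bot_sub] at h2
        have h3 : ((a + c - s : ℝ) : EReal) ≤ ⊥ := by push_cast; exact h2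
        exact EReal.coe_ne_bot _ (le_bot_iff.1 h3)
    | coe b =>
      have h3 : (a + c) - s ≤ ((b + c - t : ℝ) : EReal) := by
        refine h2.trans ?_
        push_cast
        exact EReal.sub_le_sub h1 le_rfl
      induction a with
      | bot => simp
      | top =>
        rw [EReal.top_add_coe, EReal.top_sub_coe, top_le_iff] at h3
        exact absurd h3 (EReal.coe_ne_top _)
      | coe a =>
        norm_cast at h3 ⊢
        linarith

/-- Slice each approximating Fréchet subgradient and pass to the limit. Convergence of the values of
`f` says nothing about one summand, so convergence of the values of `g` is a separate hypothesis. -/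
theorem IsLimitingSubgradient.slice {f : Z → EReal} {g : Y → EReal} (j : Y →L[ℝ] Z)
    (pr : Z →L[ℝ] Y) {y : Z} {ξ : Z →L[ℝ] ℝ} (h : IsLimitingSubgradient f y ξ)
    (hg : ∀ z : ℕ → Z, Tendsto z atTop (𝓝 y) → (∀ k, f (z k) ≠ ⊤) →
      Tendsto (fun k => g (pr (z k))) atTop (𝓝 (g (pr y))))
    (hslice : ∀ᶠ z in 𝓝 y, f z ≠ ⊤ → ∃ c : ℝ, f z = g (pr z) + c ∧
      ∀ᶠ w in 𝓝 (0 : Y), f (z + j w) ≤ g (pr z + w) + c) :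
    IsLimitingSubgradient g (pr y) (ξ.comp j) := by
  obtain ⟨z, ξk, hF, hz, -, hξ⟩ := h
  obtain ⟨N, hN⟩ := eventually_atTop.1 (hz.eventually hslice)
  have hshift : Tendsto (fun k : ℕ => k + N) atTop atTop := tendsto_add_atTop_nat N
  refine ⟨fun k => pr (z (k + N)), fun k => (ξk (k + N)).comp j, fun k => ?_, ?_, ?_, ?_⟩
  · obtain ⟨c, hc, hle⟩ := hN (k + N) (Nat.le_add_left N k) (hF (k + N)).1
    exact (hF (k + N)).slice j pr c hc hle
  · exact (pr.continuous.tendsto y).comp (hz.comp hshift)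
  · exact (hg z hz fun k => (hF k).1).comp hshift
  · have : Continuous fun ζ : Z →L[ℝ] ℝ => ζ.comp j := by fun_prop
    exact (this.tendsto ξ).comp (hξ.comp hshift)

/-- A directional lower bound along a closed cone is uniform in the direction. -/
theorem eventually_le_of_directional [FiniteDimensional ℝ X] {f : Z → ℝ} {y : Z} {s : Set Z}
    (hs : s ∈ 𝓝 y) {κ : NNReal} (hf : LipschitzOnWith κ f s) (A : X →L[ℝ] Z) {K : Set X}
    (hK : IsClosed K) (hsmul : ∀ v ∈ K, ∀ t : ℝ, 0 ≤ t → t • v ∈ K) {ψ : X → ℝ}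
    (hψ : Continuous ψ) (hψs : ∀ (t : ℝ) (v : X), 0 ≤ t → ψ (t • v) = t * ψ v)
    (hdir : ∀ w ∈ K, ∀ ε > 0, ∀ᶠ t in 𝓝[>] (0 : ℝ),
      f y - t * (ψ w + ε) ≤ f (y + t • A w)) {ε : ℝ} (hε : 0 < ε) :
    ∀ᶠ v in 𝓝 (0 : X), v ∈ K → f y ≤ f (y + A v) + ψ v + ε * ‖v‖ := by
  have hcomp : IsCompact (K ∩ Metric.sphere (0 : X) 1) := (isCompact_sphere 0 1).inter_left hK
  -- Uniformity comes from compactness of the unit directions in `K`. Passing from `σ₀` to a nearby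
  -- `σ` costs `ε / 3` each for the directional bound, for `ψ` and for the Lipschitz error in `f`.
  have key : ∀ᶠ t in 𝓝 (0 : ℝ), ∀ σ ∈ K ∩ Metric.sphere (0 : X) 1,
      0 < t → f y ≤ f (y + t • A σ) + t * ψ σ + ε * t := by
    refine hcomp.eventually_forall_of_forall_eventually fun σ₀ hσ₀ => ?_
    have h1 : ∀ᶠ p : ℝ × X in 𝓝 (0, σ₀), 0 < p.1 →
        f y - p.1 * (ψ σ₀ + ε / 3) ≤ f (y + p.1 • A σ₀) := by
      have := hdir σ₀ hσ₀.1 (ε / 3) (by positivity)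
      rw [eventually_nhdsWithin_iff] at this
      exact (continuous_fst.tendsto ((0 : ℝ), σ₀)).eventually this
    have h2 : ∀ᶠ p : ℝ × X in 𝓝 (0, σ₀), y + p.1 • A p.2 ∈ s := by
      have hc : Continuous fun p : ℝ × X => y + p.1 • A p.2 := by fun_prop
      exact hc.continuousAt (by simpa using hs)
    have h3 : ∀ᶠ p : ℝ × X in 𝓝 (0, σ₀), y + p.1 • A σ₀ ∈ s := by
      have hc : Continuous fun p : ℝ × X => y + p.1 • A σ₀ := by fun_prop
      exact hc.continuousAt (by simpa using hs)
    have h4 : ∀ᶠ p : ℝ × X in 𝓝 (0, σ₀), ψ σ₀ - ε / 3 < ψ p.2 := by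
      have hc : Continuous fun p : ℝ × X => ψ p.2 := by fun_prop
      exact hc.continuousAt (lt_mem_nhds (by simpa using hε))
    have h5 : ∀ᶠ p : ℝ × X in 𝓝 (0, σ₀), κ * ‖A p.2 - A σ₀‖ < ε / 3 := by
      have hc : Continuous fun p : ℝ × X => (κ : ℝ) * ‖A p.2 - A σ₀‖ := by fun_prop
      exact hc.continuousAt (gt_mem_nhds (by simpa using hε))
    filter_upwards [h1, h2, h3, h4, h5] with p h1 h2 h3 h4 h5 hp
    have hl := hf.dist_le_mul _ h3 _ h2
    rw [Real.dist_eq, dist_add_left, dist_eq_norm, ← smul_sub, norm_smul, Real.norm_eq_abs,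
      abs_of_pos hp, norm_sub_rev] at hl
    have h6 := (abs_le.1 hl).2
    have h7 := h1 hp
    nlinarith [mul_lt_mul_of_pos_left h4 hp, mul_lt_mul_of_pos_left h5 hp]
  have hnorm : Tendsto (fun v : X => ‖v‖) (𝓝 0) (𝓝 0) := by
    simpa using (continuous_norm (E := X)).tendsto 0
  filter_upwards [hnorm.eventually key] with v hv hvK
  rcases eq_or_ne v 0 with rfl | h0
  · have : ψ 0 = 0 := by simpa using hψs 0 0 le_rfl
    simp [this]
  · have hpos : 0 < ‖v‖ := norm_pos_iff.2 h0
    have h := hv (‖v‖⁻¹ • v) ⟨hsmul v hvK _ (by positivity), by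
      simp [norm_smul, hpos.ne']⟩ hpos
    rw [hψs _ _ (by positivity), map_smul, smul_smul, mul_inv_cancel₀ hpos.ne', one_smul,
      ← mul_assoc, mul_inv_cancel₀ hpos.ne', one_mul] at h
    exact h

/-- Penalization: approximate multipliers in Fréchet subdifferentials at nearby points. -/
theorem exists_frechetSubgradient_approx [FiniteDimensional ℝ X] [FiniteDimensional ℝ Z]
    {f : Z → ℝ} {y : Z} {s : Set Z} (hs : s ∈ 𝓝 y) {κ : NNReal} (hf : LipschitzOnWith κ f s)
    (A : X →L[ℝ] Z) {K : Set X} (hK : IsClosed K) (h0 : (0 : X) ∈ K)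
    (hadd : ∀ v ∈ K, ∀ w ∈ K, v + w ∈ K) (hsmul : ∀ v ∈ K, ∀ t : ℝ, 0 ≤ t → t • v ∈ K)
    {ψ : X → ℝ} (hψ : Continuous ψ) (hψa : ∀ v w, ψ (v + w) ≤ ψ v + ψ w)
    (hψs : ∀ (t : ℝ) (v : X), 0 ≤ t → ψ (t • v) = t * ψ v)
    (hdir : ∀ w ∈ K, ∀ ε > 0, ∀ᶠ t in 𝓝[>] (0 : ℝ),
      f y - t * (ψ w + ε) ≤ f (y + t • A w)) :
    ∃ R : ℝ, ∀ ε > 0, ∃ (z : Z) (ξ : Z →L[ℝ] ℝ), ‖z - y‖ ≤ ε ∧ ‖ξ‖ ≤ R ∧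
      IsFrechetSubgradient (fun x => (f x : EReal)) z ξ ∧
      ∀ w ∈ K, 0 ≤ ψ w + ε * ‖w‖ + ξ (A w) := by
  -- The norm of `Z` need not be smooth; Euclidean coordinates make the quadratic penalty `C^1`.
  let T : Z ≃L[ℝ] EuclideanSpace ℝ (Fin (Module.finrank ℝ Z)) := toEuclidean
  let c : ℝ := ‖(T.symm : EuclideanSpace ℝ (Fin (Module.finrank ℝ Z)) →L[ℝ] Z)‖
  have hc0 : 0 ≤ c := norm_nonneg _
  have hcT : ∀ x : Z, ‖x‖ ≤ c * ‖T x‖ := fun x => by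
    simpa using (T.symm : EuclideanSpace ℝ (Fin (Module.finrank ℝ Z)) →L[ℝ] Z).le_opNorm (T x)
  let b : ℝ := κ * c
  have hb0 : 0 ≤ b := mul_nonneg κ.2 hc0
  have hψ0 : ψ 0 = 0 := by simpa using hψs 0 0 le_rfl
  refine ⟨2 * b * ‖(T : Z →L[ℝ] EuclideanSpace ℝ (Fin (Module.finrank ℝ Z)))‖, fun ε hε => ?_⟩
  -- Only `ε / 2` is spent here; the other half of the term `ε‖v‖` in `Φ` controls the size of the
  -- minimizer.
  have hloc : ∀ᶠ v in 𝓝 (0 : X),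
      (v ∈ K → f y ≤ f (y + A v) + ψ v + ε / 2 * ‖v‖) ∧ y + A v ∈ s := by
    refine (eventually_le_of_directional hs hf A hK hsmul hψ hψs hdir (half_pos hε)).and ?_
    have hc : Continuous fun v : X => y + A v := by fun_prop
    exact hc.continuousAt (by simpa using hs)
  obtain ⟨r₁, hr₁, hloc⟩ := Metric.nhds_basis_closedBall.eventually_iff.1 hloc
  obtain ⟨r₂, hr₂, hball⟩ := Metric.nhds_basis_closedBall.mem_iff.1 hs
  obtain ⟨r, hr, hrr₁, hrr₂, hrε⟩ : ∃ r > 0, r ≤ r₁ ∧ r ≤ r₂ ∧ r ≤ ε :=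
    ⟨min (min r₁ r₂) ε, by positivity, (min_le_left _ _).trans (min_le_left _ _),
      (min_le_left _ _).trans (min_le_right _ _), min_le_right _ _⟩
  -- With `N = S / r`, the estimates `‖v₀‖ ≤ 2b²/(εN)` and `‖z₀ - y‖ ≤ ‖A‖·2b²/(εN) + cb/N` found
  -- below are both less than `r`, so the minimizer does not touch the boundary of the balls.
  let S : ℝ := 2 * b ^ 2 / ε + ‖A‖ * (2 * b ^ 2 / ε) + c * b + 1
  have hS : 0 < S := by positivity
  let N : ℝ := S / r
  have hN : 0 < N := by positivity
  let Φ : X × Z → ℝ := fun p => f p.2 + ψ p.1 + ε * ‖p.1‖ + N * ‖T (p.2 - y - A p.1)‖ ^ 2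
  have hD : IsCompact ((K ∩ Metric.closedBall (0 : X) r) ×ˢ Metric.closedBall y r) :=
    ((isCompact_closedBall 0 r).inter_left hK).prod (isCompact_closedBall y r)
  have hΦ : ContinuousOn Φ ((K ∩ Metric.closedBall (0 : X) r) ×ˢ Metric.closedBall y r) := by
    have h1 : ContinuousOn (fun p : X × Z => f p.2)
        ((K ∩ Metric.closedBall (0 : X) r) ×ˢ Metric.closedBall y r) :=
      hf.continuousOn.comp continuous_snd.continuousOn fun p hp =>
        hball (Metric.closedBall_subset_closedBall hrr₂ hp.2)
    have h2 : Continuous fun p : X × Z =>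
        ψ p.1 + ε * ‖p.1‖ + N * ‖T (p.2 - y - A p.1)‖ ^ 2 := by fun_prop
    refine (h1.add h2.continuousOn).congr fun p _ => ?_
    simp only [Φ, Pi.add_apply]
    ring
  obtain ⟨⟨v₀, z₀⟩, ⟨⟨hv₀K, hv₀⟩, hz₀⟩, hmin⟩ := hD.exists_isMinOn
    ⟨((0 : X), y), ⟨h0, by simpa using hr.le⟩, by simpa using hr.le⟩ hΦ
  have hmin' : ∀ v ∈ K, ‖v‖ ≤ r → ∀ z, ‖z - y‖ ≤ r → Φ (v₀, z₀) ≤ Φ (v, z) :=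
    fun v hv hvr z hz => hmin ⟨⟨hv, by simpa using hvr⟩, by simpa [dist_eq_norm] using hz⟩
  rw [mem_closedBall_zero_iff] at hv₀
  set d : Z := z₀ - y - A v₀ with hd
  set e : ℝ := ‖T d‖ with he
  have he0 : 0 ≤ e := norm_nonneg _
  have hbase : f z₀ + ψ v₀ + ε * ‖v₀‖ + N * e ^ 2 ≤ f y := by
    have := hmin' 0 h0 (by simpa using hr.le) y (by simpa using hr.le)
    simpa [Φ, hψ0, he, hd] using this
  have hloc₀ := hloc (x := v₀) (by simpa using hv₀.trans hrr₁)
  have hlip : f (y + A v₀) - f z₀ ≤ b * e := by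
    have h1 := hf.dist_le_mul _ hloc₀.2 _
      (hball (Metric.closedBall_subset_closedBall hrr₂ hz₀))
    rw [Real.dist_eq, dist_eq_norm, norm_sub_rev, ← sub_sub] at h1
    refine (le_abs_self _).trans (h1.trans ?_)
    have := mul_le_mul_of_nonneg_left (hcT d) κ.2
    simpa [b, mul_assoc] using this
  have hest : ε / 2 * ‖v₀‖ + N * e ^ 2 ≤ b * e := by
    have := hloc₀.1 hv₀K
    linarith
  -- This bound does not involve `ε`; it is what keeps `‖ξ‖ ≤ 2b‖T‖` along the approximation.
  have hNe : N * e ≤ b := by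
    rcases he0.eq_or_lt with h | h
    · rw [← h]; simpa using hb0
    · have : 0 ≤ ε / 2 * ‖v₀‖ := by positivity
      nlinarith
  have heN : e ≤ b / N := by rwa [le_div_iff₀ hN, mul_comm]
  have hvN : ‖v₀‖ ≤ 2 * b ^ 2 / ε / N := by
    rw [le_div_iff₀ hN, le_div_iff₀ hε]
    have h1 : ε / 2 * ‖v₀‖ ≤ b * e := by nlinarith [mul_nonneg hN.le (sq_nonneg e)]
    nlinarith [mul_le_mul_of_nonneg_left hNe hb0, mul_le_mul_of_nonneg_right h1 hN.le]
  have hSr : ∀ x, x < S → x / N < r := fun x hx => by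
    rw [div_lt_iff₀ hN]
    simp only [N]
    rwa [mul_div_cancel₀ _ hr.ne']
  have hv₀r : ‖v₀‖ < r := by
    refine hvN.trans_lt (hSr _ ?_)
    have : 0 ≤ ‖A‖ * (2 * b ^ 2 / ε) + c * b := by positivity
    simp only [S]
    linarith
  have hz₀r : ‖z₀ - y‖ < r := by
    have h1 : z₀ - y = A v₀ + d := by rw [hd]; abel
    have h2 : ‖z₀ - y‖ ≤ ‖A‖ * (2 * b ^ 2 / ε / N) + c * (b / N) := by
      rw [h1]
      refine (norm_add_le _ _).trans (add_le_add ?_ ?_)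
      · exact (A.le_opNorm v₀).trans (mul_le_mul_of_nonneg_left hvN (norm_nonneg _))
      · exact (hcT d).trans (mul_le_mul_of_nonneg_left heN hc0)
    have h3 : ‖A‖ * (2 * b ^ 2 / ε / N) + c * (b / N) =
        (‖A‖ * (2 * b ^ 2 / ε) + c * b) / N := by ring
    refine (h2.trans_eq h3).trans_lt (hSr _ ?_)
    have : 0 ≤ 2 * b ^ 2 / ε := by positivity
    simp only [S]
    linarith
  let ξ : Z →L[ℝ] ℝ := -((2 * N) • (innerSL ℝ (T d)).comp (T : Z →L[ℝ] EuclideanSpace ℝ (Fin (Module.finrank ℝ Z))))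
  have hξ : ∀ x, ξ x = -(2 * N * inner ℝ (T d) (T x)) := fun x => by simp [ξ]
  refine ⟨z₀, ξ, hz₀r.le.trans hrε, ?_, ⟨EReal.coe_ne_top _,
    fun z => -(N * ‖T (z - y - A v₀)‖ ^ 2), ?_, ?_, ?_⟩, ?_⟩
  · refine ContinuousLinearMap.opNorm_le_bound _ (by positivity) fun x => ?_
    rw [hξ, norm_neg, norm_mul, Real.norm_eq_abs, abs_of_pos (by positivity)]
    have h1 : ‖inner ℝ (T d) (T x)‖ ≤ e * (‖(T : Z →L[ℝ] EuclideanSpace ℝ (Fin (Module.finrank ℝ Z)))‖ * ‖x‖) :=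
      (norm_inner_le_norm _ _).trans
        (mul_le_mul_of_nonneg_left ((T : Z →L[ℝ] EuclideanSpace ℝ (Fin (Module.finrank ℝ Z))).le_opNorm x) he0)
    have h2 : 0 ≤ ‖(T : Z →L[ℝ] EuclideanSpace ℝ (Fin (Module.finrank ℝ Z)))‖ * ‖x‖ := by positivity
    calc 2 * N * ‖inner ℝ (T d) (T x)‖ ≤ 2 * N * (e * (‖(T : Z →L[ℝ] EuclideanSpace ℝ (Fin (Module.finrank ℝ Z)))‖ * ‖x‖)) := by gcongr
      _ = 2 * (N * e) * (‖(T : Z →L[ℝ] EuclideanSpace ℝ (Fin (Module.finrank ℝ Z)))‖ * ‖x‖) := by ring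
      _ ≤ 2 * b * (‖(T : Z →L[ℝ] EuclideanSpace ℝ (Fin (Module.finrank ℝ Z)))‖ * ‖x‖) := by gcongr
      _ = _ := by ring
  · have h1 : ContDiff ℝ 1 fun z : Z => T (z - y - A v₀) := by fun_prop
    exact ((contDiff_const.mul (h1.norm_sq ℝ)).neg).contDiffAt
  · have h1 : HasFDerivAt (fun z : Z => T (z - y - A v₀)) (T : Z →L[ℝ] EuclideanSpace ℝ (Fin (Module.finrank ℝ Z))) z₀ :=
      (T : Z →L[ℝ] EuclideanSpace ℝ (Fin (Module.finrank ℝ Z))).hasFDerivAt.comp z₀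
        (((hasFDerivAt_id z₀).sub_const y).sub_const (A v₀))
    rw [((h1.norm_sq.const_mul N).fun_neg).fderiv]
    ext x
    simp [hξ, hd, inner_sub_left]
    ring
  · have : ∀ᶠ z in 𝓝 z₀, ‖z - y‖ < r := by
      have hc : Continuous fun z : Z => ‖z - y‖ := by fun_prop
      exact hc.continuousAt (gt_mem_nhds hz₀r)
    filter_upwards [this] with z hz
    have h1 := hmin' v₀ hv₀K hv₀ z hz.le
    simp only [Φ] at h1
    norm_cast
    linarith
  · intro w hw
    -- Compare the minimizer with `(v₀ + t w, z₀)`, which is admissible because `K` is a convex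
    -- cone. Sublinearity of `ψ` and of the norm removes `v₀`, and after division by `t` the
    -- quadratic term vanishes in the limit.
    have h1 : ∀ᶠ t in 𝓝[>] (0 : ℝ),
        0 ≤ ψ w + ε * ‖w‖ + ξ (A w) + t * (N * ‖T (A w)‖ ^ 2) := by
      have h2 : ∀ᶠ t in 𝓝[>] (0 : ℝ), ‖v₀ + t • w‖ < r := by
        have hc : Continuous fun t : ℝ => ‖v₀ + t • w‖ := by fun_prop
        have hm : ∀ᶠ t in 𝓝 (0 : ℝ), ‖v₀ + t • w‖ < r :=
          hc.continuousAt (gt_mem_nhds (by simpa using hv₀r))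
        exact hm.filter_mono nhdsWithin_le_nhds
      filter_upwards [h2, self_mem_nhdsWithin] with t ht (ht0 : 0 < t)
      have h3 := hmin' (v₀ + t • w) (hadd _ hv₀K _ (hsmul w hw t ht0.le)) ht.le z₀ hz₀r.le
      simp only [Φ] at h3
      have h4 : T (z₀ - y - A (v₀ + t • w)) = T d - t • T (A w) := by
        rw [← map_smul T, ← map_sub T]
        congr 1
        rw [hd, map_add, map_smul]
        abel
      have h5 : ‖T d - t • T (A w)‖ ^ 2 =
          e ^ 2 - 2 * t * inner ℝ (T d) (T (A w)) + t ^ 2 * ‖T (A w)‖ ^ 2 := by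
        rw [norm_sub_sq_real, real_inner_smul_right, norm_smul, Real.norm_eq_abs, mul_pow, sq_abs]
        ring
      have h6 : ψ (v₀ + t • w) ≤ ψ v₀ + t * ψ w := (hψa _ _).trans_eq (by rw [hψs _ _ ht0.le])
      have h7 : ‖v₀ + t • w‖ ≤ ‖v₀‖ + t * ‖w‖ :=
        (norm_add_le _ _).trans_eq (by rw [norm_smul, Real.norm_eq_abs, abs_of_pos ht0])
      rw [h4, h5] at h3
      rw [hξ]
      have h8 := mul_le_mul_of_nonneg_left h7 hε.le
      have h9 : 0 ≤ t * (ψ w + ε * ‖w‖ + -(2 * N * inner ℝ (T d) (T (A w))) +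
          t * (N * ‖T (A w)‖ ^ 2)) := by
        rw [← he] at h3
        linear_combination h3 + h6 + h8
      exact nonneg_of_mul_nonneg_right h9 ht0
    have h2 : Tendsto (fun t : ℝ => ψ w + ε * ‖w‖ + ξ (A w) + t * (N * ‖T (A w)‖ ^ 2))
        (𝓝[>] 0) (𝓝 (ψ w + ε * ‖w‖ + ξ (A w))) := by
      have hc : Continuous fun t : ℝ =>
        ψ w + ε * ‖w‖ + ξ (A w) + t * (N * ‖T (A w)‖ ^ 2) := by fun_prop
      simpa using (hc.tendsto 0).mono_left nhdsWithin_le_nhds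
    exact ge_of_tendsto h2 h1

/-- Multiplier rule: a directional lower bound for `f ∘ (y + A ·)` on a closed convex cone is
witnessed by a single limiting subgradient of `f`. -/
theorem exists_limitingSubgradient_of_directional [FiniteDimensional ℝ X] [FiniteDimensional ℝ Z]
    {f : Z → ℝ} {y : Z} {s : Set Z} (hs : s ∈ 𝓝 y) {κ : NNReal} (hf : LipschitzOnWith κ f s)
    (A : X →L[ℝ] Z) {K : Set X} (hK : IsClosed K) (h0 : (0 : X) ∈ K)
    (hadd : ∀ v ∈ K, ∀ w ∈ K, v + w ∈ K) (hsmul : ∀ v ∈ K, ∀ t : ℝ, 0 ≤ t → t • v ∈ K)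
    {ψ : X → ℝ} (hψ : Continuous ψ) (hψa : ∀ v w, ψ (v + w) ≤ ψ v + ψ w)
    (hψs : ∀ (t : ℝ) (v : X), 0 ≤ t → ψ (t • v) = t * ψ v)
    (hdir : ∀ w ∈ K, ∀ ε > 0, ∀ᶠ t in 𝓝[>] (0 : ℝ),
      f y - t * (ψ w + ε) ≤ f (y + t • A w)) :
    ∃ ξ : Z →L[ℝ] ℝ, IsLimitingSubgradient (fun x => (f x : EReal)) y ξ ∧
      ∀ w ∈ K, 0 ≤ ψ w + ξ (A w) := by
  obtain ⟨R, hR⟩ := exists_frechetSubgradient_approx hs hf A hK h0 hadd hsmul hψ hψa hψs hdir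
  choose z ξ hz hξR hF hw using fun k : ℕ => hR (1 / ((k : ℝ) + 1)) (by positivity)
  -- The uniform bound `R` and finite dimension give a convergent subsequence of multipliers.
  have : ProperSpace (Z →L[ℝ] ℝ) := FiniteDimensional.proper_real _
  obtain ⟨ζ, -, φ, hφ, hζ⟩ := tendsto_subseq_of_bounded (x := ξ)
    (Metric.isBounded_closedBall (x := (0 : Z →L[ℝ] ℝ)) (r := R)) fun k => by simpa using hξR k
  have h1 : Tendsto (fun k => 1 / ((φ k : ℝ) + 1)) atTop (𝓝 0) :=
    tendsto_one_div_add_atTop_nhds_zero_nat.comp hφ.tendsto_atTop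
  have hzy : Tendsto (fun k => z (φ k)) atTop (𝓝 y) :=
    tendsto_iff_norm_sub_tendsto_zero.2
      (squeeze_zero (fun _ => norm_nonneg _) (fun k => hz (φ k)) h1)
  refine ⟨ζ, ⟨fun k => z (φ k), fun k => ξ (φ k), fun k => hF (φ k), hzy, ?_, hζ⟩, fun w hwK => ?_⟩
  · have hc : ContinuousAt f y := hf.continuousOn.continuousAt hs
    exact (continuous_coe_real_ereal.tendsto _).comp (hc.tendsto.comp hzy)
  · have h2 : Tendsto (fun k => ψ w + 1 / ((φ k : ℝ) + 1) * ‖w‖ + ξ (φ k) (A w)) atTop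
        (𝓝 (ψ w + 0 * ‖w‖ + ζ (A w))) :=
      ((h1.mul_const _).const_add _).add
        (((ContinuousLinearMap.apply ℝ ℝ (A w)).continuous.tendsto ζ).comp hζ)
    simpa using ge_of_tendsto' h2 fun k => hw (φ k) w hwK

end VectorSpace

/-! ### Subgradients on a manifold, read in the preferred chart. -/

section Coordinates

variable {E : Type*} [NormedAddCommGroup E] [NormedSpace ℝ E]
  {H : Type*} [TopologicalSpace H] (I : ModelWithCorners ℝ E H)
  {M : Type*} [TopologicalSpace M] [ChartedSpace H M]

/-- The coordinates of a covector at `x` in the preferred chart at `q`. -/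
def coordCovector (q : M) {x : M} (p : Cotangent I x) : E →L[ℝ] ℝ :=
  ContinuousLinearMap.comp (M₂ := E) (show E →L[ℝ] ℝ from p)
    (mfderivWithin 𝓘(ℝ, E) I (extChartAt I q).symm (range I) (extChartAt I q x))

theorem coordCovector_self [IsManifold I 1 M] (q : M) (p : Cotangent I q) :
    coordCovector I q p = (show E →L[ℝ] ℝ from p) := by
  rw [coordCovector, mfderivWithin_range_extChartAt_symm]
  rfl

theorem inCoordinates_eq_coordCovector [IsManifold I 1 M] {q x : M}
    (hx : x ∈ (chartAt H q).source) (p : Cotangent I x) :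
    ContinuousLinearMap.inCoordinates E (TangentSpace I) ℝ (Bundle.Trivial M ℝ) q x q x p =
      coordCovector I q p := by
  have h1 := TangentBundle.symmL_trivializationAt (𝕜 := ℝ) (I := I) hx
  have h2 : (trivializationAt ℝ (Bundle.Trivial M ℝ) q).continuousLinearMapAt ℝ x =
      ContinuousLinearMap.id ℝ ℝ := Bundle.Trivial.continuousLinearMapAt_trivialization ℝ M ℝ x
  ext v
  exact (congrArg (fun T : ℝ →L[ℝ] ℝ => T (p ((trivializationAt E (TangentSpace I) q).symmL ℝ x v)))
    h2).trans (congrArg (fun T : E →L[ℝ] TangentSpace I x => p (T v)) h1)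

/-- The local trivialization of the cotangent bundle at `q` is `coordCovector`, so bundle
convergence reduces to convergence in a fixed normed space. -/
theorem tendsto_cotangentBundle_iff [IsManifold I 1 M] {α : Type*} {l : Filter α} {x : α → M}
    {pk : ∀ k, Cotangent I (x k)} {q : M} {p : Cotangent I q} :
    Tendsto (fun k => (⟨x k, pk k⟩ : CotangentBundle I M)) l (𝓝 ⟨q, p⟩) ↔
      Tendsto x l (𝓝 q) ∧
        Tendsto (fun k => coordCovector I q (pk k)) l (𝓝 (show E →L[ℝ] ℝ from p)) := by
  have h := (trivializationAt (E →L[ℝ] ℝ)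
    (fun q : M => TangentSpace I q →L[ℝ] Bundle.Trivial M ℝ q) q).tendsto_nhds_iff
    (l := l) (f := fun k => (⟨x k, pk k⟩ : CotangentBundle I M)) (z := ⟨q, p⟩)
    (FiberBundle.mem_trivializationAt_proj_source (x := (⟨q, p⟩ : CotangentBundle I M)))
  rw [h]
  refine and_congr_right fun hx => ?_
  have hp : ((trivializationAt (E →L[ℝ] ℝ)
      (fun q : M => TangentSpace I q →L[ℝ] Bundle.Trivial M ℝ q) q)
      (⟨q, p⟩ : CotangentBundle I M)).2 = (show E →L[ℝ] ℝ from p) :=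
    (inCoordinates_eq_coordCovector I (mem_chart_source H q) p).trans (coordCovector_self I q p)
  rw [hp]
  refine tendsto_congr' ?_
  filter_upwards [hx ((chartAt H q).open_source.mem_nhds (mem_chart_source H q))] with k hk
  exact inCoordinates_eq_coordCovector I hk (pk k)

variable {I}

theorem coordCovector_eq [I.Boundaryless] (q : M) {x : M} (p : Cotangent I x) :
    coordCovector I q p = ContinuousLinearMap.comp (M₂ := E) (show E →L[ℝ] ℝ from p)
      (mfderiv 𝓘(ℝ, E) I (extChartAt I q).symm (extChartAt I q x)) := by
  unfold coordCovector
  rw [I.range_eq_univ, mfderivWithin_univ]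
  rfl

theorem coordCovector_mfderiv [I.Boundaryless] [IsManifold I 1 M] {q x : M}
    (hx : x ∈ (chartAt H q).source) {g : M → ℝ} (hg : MDifferentiableAt I 𝓘(ℝ, ℝ) g x) :
    coordCovector I q (mfderiv I 𝓘(ℝ, ℝ) g x) =
      fderiv ℝ (g ∘ (extChartAt I q).symm) (extChartAt I q x) := by
  have hx' : x ∈ (extChartAt I q).source := by rwa [extChartAt_source]
  have hs : MDifferentiableAt 𝓘(ℝ, E) I (extChartAt I q).symm (extChartAt I q x) := by
    have := mdifferentiableWithinAt_extChartAt_symm (I := I) ((extChartAt I q).map_source hx')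
    rwa [I.range_eq_univ, mdifferentiableWithinAt_univ] at this
  rw [← mfderiv_eq_fderiv, mfderiv_comp_of_eq (y := x) hg hs ((extChartAt I q).left_inv hx')]
  exact (coordCovector_eq q _).trans (congrArg (fun y : M => ContinuousLinearMap.comp (M₂ := E)
    (show E →L[ℝ] ℝ from mfderiv I 𝓘(ℝ, ℝ) g y)
    (mfderiv 𝓘(ℝ, E) I (extChartAt I q).symm (extChartAt I q x)))
    ((extChartAt I q).left_inv hx').symm)

/-- Multiplication by a bump function. Fréchet subgradients on `M` require globally defined test
functions, while a chart supplies only germs. -/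
theorem exists_contMDiff_eventuallyEq [FiniteDimensional ℝ E] [T2Space M] [IsManifold I ∞ M]
    {g : M → ℝ} {x : M} (hg : ContMDiffAt I 𝓘(ℝ, ℝ) 1 g x) :
    ∃ g' : M → ℝ, ContMDiff I 𝓘(ℝ, ℝ) 1 g' ∧ g' =ᶠ[𝓝 x] g := by
  have : IsManifold I 1 M := IsManifold.of_le (n := ∞) (by simp)
  have hev := (contMDiffAt_iff_contMDiffAt_nhds (by simp)).1 hg
  obtain ⟨ρ, -, hρ⟩ := (SmoothBumpFunction.nhds_basis_tsupport (I := I) x).mem_iff.1 hev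
  refine ⟨fun y => ρ y • g y, contMDiff_of_tsupport fun y hy => ?_, ?_⟩
  · have h1 : ContMDiffAt I 𝓘(ℝ, ℝ) 1 ρ y := ρ.contMDiffAt.of_le (by simp)
    exact h1.smul (hρ (tsupport_smul_subset_left _ _ hy))
  · filter_upwards [ρ.eventuallyEq_one] with y hy
    simp [hy]

theorem isFrechetSubgradient_coord [I.Boundaryless] [IsManifold I 1 M] {f : M → EReal} {q x : M}
    (hx : x ∈ (chartAt H q).source) {p : Cotangent I x} (hp : p ∈ frechetSubdiff I f x) :
    IsFrechetSubgradient (f ∘ (extChartAt I q).symm) (extChartAt I q x) (coordCovector I q p) := by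
  obtain ⟨hf, g, hg, rfl, hmin⟩ := hp
  have hx' : x ∈ (extChartAt I q).source := by rwa [extChartAt_source]
  have hz := (extChartAt I q).map_source hx'
  have hinv := (extChartAt I q).left_inv hx'
  refine ⟨by rwa [Function.comp_apply, hinv], g ∘ (extChartAt I q).symm, ?_,
    (coordCovector_mfderiv hx (hg.mdifferentiable one_ne_zero x)).symm, ?_⟩
  · have hs : ContMDiffAt 𝓘(ℝ, E) I 1 (extChartAt I q).symm (extChartAt I q x) :=
      (contMDiffOn_extChartAt_symm q).contMDiffAt (extChartAt_target_mem_nhds' hz)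
    exact (hg.contMDiffAt.comp (extChartAt I q x) hs).contDiffAt
  · have hc : Tendsto (extChartAt I q).symm (𝓝 (extChartAt I q x)) (𝓝 x) := by
      simpa only [ContinuousAt, hinv] using continuousAt_extChartAt_symm'' hz
    filter_upwards [hc.eventually hmin] with y hy
    simpa only [Function.comp_apply, hinv] using hy

theorem exists_mem_frechetSubdiff_of_coord [I.Boundaryless] [FiniteDimensional ℝ E] [T2Space M]
    [IsManifold I ∞ M] {f : M → EReal} {q : M} {z : E} (hz : z ∈ (extChartAt I q).target)
    {ξ : E →L[ℝ] ℝ} (h : IsFrechetSubgradient (f ∘ (extChartAt I q).symm) z ξ) :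
    ∃ p ∈ frechetSubdiff I f ((extChartAt I q).symm z), coordCovector I q p = ξ := by
  have : IsManifold I 1 M := IsManifold.of_le (n := ∞) (by simp)
  obtain ⟨hf, h, hh, rfl, hmin⟩ := h
  have hx' := (extChartAt I q).map_target hz
  have hx : (extChartAt I q).symm z ∈ (chartAt H q).source := by rwa [extChartAt_source] at hx'
  have hinv := (extChartAt I q).right_inv hz
  have hφ : ContMDiffAt I 𝓘(ℝ, E) 1 (extChartAt I q) ((extChartAt I q).symm z) :=
    contMDiffAt_extChartAt' hx
  have hh' : ContMDiffAt 𝓘(ℝ, E) 𝓘(ℝ, ℝ) 1 h (extChartAt I q ((extChartAt I q).symm z)) := by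
    rw [hinv]
    exact hh.contMDiffAt
  obtain ⟨g, hg, hgh⟩ := exists_contMDiff_eventuallyEq (hh'.comp _ hφ)
  refine ⟨mfderiv I 𝓘(ℝ, ℝ) g ((extChartAt I q).symm z), ⟨hf, g, hg, rfl, ?_⟩, ?_⟩
  · have hc : Tendsto (extChartAt I q) (𝓝 ((extChartAt I q).symm z)) (𝓝 z) := by
      simpa only [ContinuousAt, hinv] using hφ.continuousAt
    filter_upwards [hc.eventually hmin, hgh, extChartAt_source_mem_nhds' hx'] with y hy hgy hys
    rw [hgy, hgh.self_of_nhds]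
    simpa only [Function.comp_apply, hinv, (extChartAt I q).left_inv hys] using hy
  · rw [coordCovector_mfderiv hx (hg.mdifferentiable one_ne_zero _), hinv]
    refine Filter.EventuallyEq.fderiv_eq ?_
    have hc : Tendsto (extChartAt I q).symm (𝓝 z) (𝓝 ((extChartAt I q).symm z)) :=
      continuousAt_extChartAt_symm'' hz
    filter_upwards [hc.eventually hgh, extChartAt_target_mem_nhds' hz] with y hy hyt
    simp only [Function.comp_apply, hy, (extChartAt I q).right_inv hyt]

/-- Limiting subgradients on a manifold can be computed in the preferred chart. -/
theorem mem_limitingSubdiff_iff [I.Boundaryless] [FiniteDimensional ℝ E] [T2Space M]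
    [IsManifold I ∞ M] [IsManifold I 1 M] {f : M → EReal} {q : M} {p : Cotangent I q} :
    p ∈ limitingSubdiff I f q ↔
      IsLimitingSubgradient (f ∘ (extChartAt I q).symm) (extChartAt I q q)
        (show E →L[ℝ] ℝ from p) := by
  constructor
  · rintro ⟨x, pk, hF, hx, hfx, hp⟩
    have hp' := ((tendsto_cotangentBundle_iff I).1 hp).2
    obtain ⟨N, hN⟩ := eventually_atTop.1
      (hx ((chartAt H q).open_source.mem_nhds (mem_chart_source H q)))
    have hshift : Tendsto (fun k : ℕ => k + N) atTop atTop := tendsto_add_atTop_nat N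
    have hmem : ∀ k, x (k + N) ∈ (chartAt H q).source := fun k => hN _ (Nat.le_add_left N k)
    refine ⟨fun k => extChartAt I q (x (k + N)), fun k => coordCovector I q (pk (k + N)),
      fun k => isFrechetSubgradient_coord (hmem k) (hF _), ?_, ?_, hp'.comp hshift⟩
    · exact (continuousAt_extChartAt q).tendsto.comp (hx.comp hshift)
    · have : ∀ k, (extChartAt I q).symm (extChartAt I q (x (k + N))) = x (k + N) := fun k =>
        (extChartAt I q).left_inv (by rw [extChartAt_source]; exact hmem k)
      simp only [Function.comp_apply, this, extChartAt_to_inv]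
      exact hfx.comp hshift
  · rintro ⟨z, ξk, hF, hz, hfz, hξ⟩
    obtain ⟨N, hN⟩ := eventually_atTop.1 (hz (extChartAt_target_mem_nhds q))
    have hshift : Tendsto (fun k : ℕ => k + N) atTop atTop := tendsto_add_atTop_nat N
    choose pk hpF hpc using fun k =>
      exists_mem_frechetSubdiff_of_coord (hN (k + N) (Nat.le_add_left N k)) (hF (k + N))
    have hx : Tendsto (fun k => (extChartAt I q).symm (z (k + N))) atTop (𝓝 q) := by
      have := (continuousAt_extChartAt_symm (I := I) q).tendsto
      rw [extChartAt_to_inv] at this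
      exact this.comp (hz.comp hshift)
    refine ⟨_, pk, hpF, hx, ?_, (tendsto_cotangentBundle_iff I).2 ⟨hx, ?_⟩⟩
    · simpa only [Function.comp_def, extChartAt_to_inv] using hfz.comp hshift
    · simp only [hpc]
      exact hξ.comp hshift

/-- A locally Lipschitz function is Lipschitz near the base point in the preferred chart. -/
theorem IsLocallyLipschitz.exists_lipschitzOnWith [I.Boundaryless] [IsManifold I ∞ M] {f : M → ℝ}
    (hf : IsLocallyLipschitz I f) (q : M) :
    ∃ (κ : NNReal), ∃ s ∈ 𝓝 (extChartAt I q q),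
      LipschitzOnWith κ (f ∘ (extChartAt I q).symm) s := by
  have : IsManifold I 1 M := IsManifold.of_le (n := ∞) (by simp)
  obtain ⟨φ, hφ, hq, K, hK⟩ := hf q
  have hφ1 : φ ∈ IsManifold.maximalAtlas I 1 M :=
    (contDiffGroupoid_le (by simp) : contDiffGroupoid ∞ I ≤ contDiffGroupoid 1 I) |>
      fun hle => StructureGroupoid.maximalAtlas_mono hle hφ
  have hφq : ContMDiffAt I 𝓘(ℝ, E) 1 (φ.extend I) q := φ.contMDiffAt_extend hφ1 hq
  have hs : ContMDiffAt 𝓘(ℝ, E) I 1 (extChartAt I q).symm (extChartAt I q q) :=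
    (contMDiffOn_extChartAt_symm q).contMDiffAt (extChartAt_target_mem_nhds q)
  have hφq' : ContMDiffAt I 𝓘(ℝ, E) 1 (φ.extend I)
      ((extChartAt I q).symm (extChartAt I q q)) := by rwa [extChartAt_to_inv]
  -- The transition from the preferred chart to the chart in which `f` is Lipschitz is `C^1`, hence
  -- locally Lipschitz.
  obtain ⟨K', s, hs', hK'⟩ := ((hφq'.comp _ hs).contDiffAt.exists_lipschitzOnWith)
  have hsrc : ∀ᶠ z in 𝓝 (extChartAt I q q), (extChartAt I q).symm z ∈ φ.source := by
    refine hs.continuousAt ?_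
    rw [extChartAt_to_inv]
    exact φ.open_source.mem_nhds hq
  refine ⟨K * K', s ∩ {z | (extChartAt I q).symm z ∈ φ.source}, inter_mem hs' hsrc, ?_⟩
  have hmaps : MapsTo (φ.extend I ∘ (extChartAt I q).symm)
      (s ∩ {z | (extChartAt I q).symm z ∈ φ.source}) (φ.extend I).target := fun z hz =>
    (φ.extend I).map_source (by rw [φ.extend_source]; exact hz.2)
  have hinv : ∀ z ∈ s ∩ {z | (extChartAt I q).symm z ∈ φ.source},
      (φ.extend I).symm (φ.extend I ((extChartAt I q).symm z)) = (extChartAt I q).symm z :=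
    fun z hz => (φ.extend I).left_inv (by rw [φ.extend_source]; exact hz.2)
  intro z hz z' hz'
  simpa only [Function.comp_apply, hinv z hz, hinv z' hz'] using
    hK.comp (hK'.mono inter_subset_left) hmaps hz hz'

/-- A curve through `q` whose preferred-chart representation has derivative `v` at `0`. -/
def HasCurveDeriv (I : ModelWithCorners ℝ E H) (γ : ℝ → M) (q : M) (v : E) : Prop :=
  γ 0 = q ∧ ContinuousAt γ 0 ∧ HasDerivAt (fun t => extChartAt I q (γ t)) v 0

theorem HasCurveDeriv.hasMFDerivAt [I.Boundaryless] {γ : ℝ → M} {q : M} {v : E}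
    (h : HasCurveDeriv I γ q v) :
    HasMFDerivAt 𝓘(ℝ, ℝ) I γ 0 (ContinuousLinearMap.toSpanSingleton (M₁ := E) ℝ v) := by
  obtain ⟨rfl, hc, hd⟩ := h
  refine ⟨hc, ?_⟩
  have : writtenInExtChartAt 𝓘(ℝ, ℝ) I 0 γ = fun t => extChartAt I (γ 0) (γ t) := by
    ext t; rfl
  rw [this]
  exact hd.hasFDerivAt.hasFDerivWithinAt

end Coordinates

/-! ### Smooth curves and their images under maps. -/

section Curves

variable {E : Type*} [NormedAddCommGroup E] [NormedSpace ℝ E]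
  {H : Type*} [TopologicalSpace H] {I : ModelWithCorners ℝ E H}
  {M : Type*} [TopologicalSpace M] [ChartedSpace H M]

theorem hasCurveDeriv_of_hasMFDerivAt [I.Boundaryless] {γ : ℝ → M} {v : E}
    (h : HasMFDerivAt 𝓘(ℝ, ℝ) I γ 0 (ContinuousLinearMap.toSpanSingleton (M₁ := E) ℝ v)) :
    HasCurveDeriv I γ (γ 0) v := by
  refine ⟨rfl, h.1, ?_⟩
  have h2 : HasFDerivWithinAt (fun t : ℝ => extChartAt I (γ 0) (γ t))
      (ContinuousLinearMap.toSpanSingleton ℝ v) (range 𝓘(ℝ, ℝ)) (0 : ℝ) := h.2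
  rw [modelWithCornersSelf_coe, range_id, hasFDerivWithinAt_univ] at h2
  exact hasDerivAt_iff_hasFDerivAt.2 h2

theorem HasCurveDeriv.isSmoothCurveThrough [I.Boundaryless] {γ : ℝ → M} {q : M} {v : E}
    (h : HasCurveDeriv I γ q v) (hγ : ContMDiff 𝓘(ℝ, ℝ) I ∞ γ) :
    IsSmoothCurveThrough I γ q (show TangentSpace I q from v) := by
  obtain ⟨rfl, -, -⟩ := id h
  refine ⟨hγ, ?_⟩
  have h1 := h.hasMFDerivAt.mfderiv
  refine congrArg (fun w : TangentSpace I (γ 0) => (⟨γ 0, w⟩ : TangentBundle I M)) ?_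
  refine (congrArg (fun T : ℝ →L[ℝ] E => T (1 : ℝ)) h1).trans ?_
  exact one_smul ℝ v

/-- A straight line in the chart would leave its target. The parameter `r sin (t / r)` has
derivative `1` at `0` and modulus at most `r`, so the curve is defined for all times. -/
theorem exists_smooth_curve [I.Boundaryless] [IsManifold I ∞ M] (q : M) (v : E) :
    ∃ γ : ℝ → M, ContMDiff 𝓘(ℝ, ℝ) I ∞ γ ∧ HasCurveDeriv I γ q v := by
  obtain ⟨δ, hδ, hball⟩ := Metric.mem_nhds_iff.1 (extChartAt_target_mem_nhds (I := I) q)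
  let r : ℝ := δ / (2 * (‖v‖ + 1))
  have hr : 0 < r := by positivity
  let c : ℝ → E := fun t => extChartAt I q q + (r * Real.sin (t / r)) • v
  have hc : ContDiff ℝ ∞ c := by
    have : ContDiff ℝ ∞ fun t : ℝ => Real.sin (t / r) := Real.contDiff_sin.comp (by fun_prop)
    exact contDiff_const.add ((contDiff_const.mul this).smul contDiff_const)
  have hmem : ∀ t, c t ∈ (extChartAt I q).target := fun t => by
    refine hball ?_
    rw [mem_ball_iff_norm, add_sub_cancel_left, norm_smul, Real.norm_eq_abs, abs_mul,
      abs_of_pos hr]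
    have h1 := Real.abs_sin_le_one (t / r)
    have h2 : r * (2 * (‖v‖ + 1)) = δ := by
      simp only [r]; field_simp
    have h3 : r * |Real.sin (t / r)| * ‖v‖ ≤ r * 1 * ‖v‖ := by gcongr
    nlinarith [norm_nonneg v]
  have hc0 : c 0 = extChartAt I q q := by simp [c]
  have hsm : ContMDiff 𝓘(ℝ, ℝ) I ∞ fun t => (extChartAt I q).symm (c t) :=
    (contMDiffOn_extChartAt_symm q).comp_contMDiff hc.contMDiff hmem
  refine ⟨_, hsm, (congrArg _ hc0).trans (extChartAt_to_inv q), hsm.continuous.continuousAt, ?_⟩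
  simp only [(extChartAt I q).right_inv (hmem _)]
  have h1 : HasDerivAt (fun t : ℝ => r * Real.sin (t / r)) 1 0 := by
    have := (((hasDerivAt_id (0 : ℝ)).div_const r).sin).const_mul r
    simpa [hr.ne'] using this
  simpa [c] using (h1.smul_const v).const_add (extChartAt I q q)

variable {E' : Type*} [NormedAddCommGroup E'] [NormedSpace ℝ E']
  {H' : Type*} [TopologicalSpace H'] {I' : ModelWithCorners ℝ E' H'}
  {M' : Type*} [TopologicalSpace M'] [ChartedSpace H' M']
  {E'' : Type*} [NormedAddCommGroup E''] [NormedSpace ℝ E'']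
  {H'' : Type*} [TopologicalSpace H''] {I'' : ModelWithCorners ℝ E'' H''}
  {M'' : Type*} [TopologicalSpace M''] [ChartedSpace H'' M'']

theorem HasCurveDeriv.comp₂ [I.Boundaryless] [I'.Boundaryless] [I''.Boundaryless]
    {F : M × M' → M''} {γ : ℝ → M} {γ' : ℝ → M'} {q : M} {q' : M'} {v : E} {v' : E'}
    (hF : MDifferentiableAt (I.prod I') I'' F (q, q')) (h : HasCurveDeriv I γ q v)
    (h' : HasCurveDeriv I' γ' q' v') :
    HasCurveDeriv I'' (fun t => F (γ t, γ' t)) (F (q, q'))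
      ((show E →L[ℝ] E'' from mfderiv I I'' (fun x => F (x, q')) q) v +
        (show E' →L[ℝ] E'' from mfderiv I' I'' (fun x => F (q, x)) q') v') := by
  obtain ⟨rfl, -, -⟩ := id h
  obtain ⟨rfl, -, -⟩ := id h'
  have h1 := HasMFDerivAt.comp (0 : ℝ) hF.hasMFDerivAt (h.hasMFDerivAt.prodMk h'.hasMFDerivAt)
  refine hasCurveDeriv_of_hasMFDerivAt (γ := fun t => F (γ t, γ' t)) (h1.congr_mfderiv ?_)
  refine ContinuousLinearMap.ext_ring ?_
  have h2 := mfderiv_prod_eq_add_apply (v := ((v, v') : E × E')) hF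
  refine Eq.trans ?_ (h2.trans ?_)
  · exact congrArg (fun w : E × E' => (show E × E' →L[ℝ] E'' from
      mfderiv (I.prod I') I'' F (γ 0, γ' 0)) w) (Prod.ext (one_smul ℝ v) (one_smul ℝ v'))
  · exact (one_smul ℝ _).symm

end Curves

/-! ### Normal and tangent cones of product sets. -/

section Product

variable {ι : Type*} [Fintype ι] {V : ι → Type*} [∀ i, NormedAddCommGroup (V i)]
  [∀ i, NormedSpace ℝ (V i)]
  {U : ι → Type*} [∀ i, TopologicalSpace (U i)] [∀ i, ChartedSpace (V i) (U i)]

instance piModel_boundaryless : (piModel V).Boundaryless where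
  range_eq_univ := by
    change range (fun x : ∀ i, V i => x) = univ
    exact range_id

theorem HasCurveDeriv.apply {γ : ℝ → ∀ i, U i} {u : ∀ i, U i} {w : ∀ i, V i}
    (h : HasCurveDeriv (piModel V) γ u w) (i : ι) :
    HasCurveDeriv 𝓘(ℝ, V i) (fun t => γ t i) (u i) (w i) :=
  ⟨congrFun h.1 i, (continuous_apply i).continuousAt.comp h.2.1, hasDerivAt_pi.1 h.2.2 i⟩

theorem indicatorTop_of_mem {M : Type*} {S : Set M} {x : M} (h : x ∈ S) :
    indicatorTop S x = 0 := if_pos h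

theorem indicatorTop_ne_top {M : Type*} {S : Set M} {x : M} :
    indicatorTop S x ≠ ⊤ ↔ x ∈ S := by
  by_cases h : x ∈ S <;> simp [indicatorTop, h]

/-- The components of a limiting normal to a product are limiting normals to the factors. -/
theorem comp_single_mem_limitingNormalCone [DecidableEq ι] [∀ i, FiniteDimensional ℝ (V i)]
    [∀ i, T2Space (U i)] [∀ i, IsManifold 𝓘(ℝ, V i) ∞ (U i)] [∀ i, IsManifold 𝓘(ℝ, V i) 1 (U i)]
    {C : ∀ i, Set (U i)} {u : ∀ i, U i} (hu : ∀ i, u i ∈ C i)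
    {p : Cotangent (piModel V) u}
    (hp : p ∈ limitingNormalCone (piModel V) {w : ∀ i, U i | ∀ i, w i ∈ C i} u) (i : ι) :
    (show (∀ i, V i) →L[ℝ] ℝ from p).comp (ContinuousLinearMap.single ℝ V i) ∈
      limitingNormalCone 𝓘(ℝ, V i) (C i) (u i) := by
  refine mem_limitingSubdiff_iff.2 ?_
  have h := mem_limitingSubdiff_iff.1 hp
  refine h.slice (ContinuousLinearMap.single ℝ V i) (ContinuousLinearMap.proj i) ?_ ?_
  · intro z hz hzt
    refine tendsto_const_nhds.congr fun k => ?_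
    have h1 := indicatorTop_ne_top.1 (hzt k)
    refine Eq.trans ?_ (indicatorTop_of_mem (h1 i)).symm
    exact indicatorTop_of_mem (by
      change (extChartAt 𝓘(ℝ, V i) (u i)).symm (extChartAt 𝓘(ℝ, V i) (u i) (u i)) ∈ C i
      rw [extChartAt_to_inv]
      exact hu i)
  -- At a point of the product set, moving the `i`-th coordinate alone stays in the set as soon as
  -- that coordinate stays in `C i`.
  · refine Eventually.of_forall fun z hz => ⟨0, ?_, Eventually.of_forall fun w => ?_⟩
    · have h1 := indicatorTop_ne_top.1 hz
      rw [EReal.coe_zero, add_zero]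
      exact (indicatorTop_of_mem h1).trans (indicatorTop_of_mem (h1 i)).symm
    · have h1 := indicatorTop_ne_top.1 hz
      rw [EReal.coe_zero, add_zero]
      by_cases hw : (extChartAt 𝓘(ℝ, V i) (u i)).symm (z i + w) ∈ C i
      · refine ((indicatorTop_of_mem ?_).trans (indicatorTop_of_mem hw).symm).le
        intro k
        change (extChartAt 𝓘(ℝ, V k) (u k)).symm (z k + Pi.single (M := V) i w k) ∈ C k
        rcases eq_or_ne k i with rfl | hk
        · rwa [Pi.single_eq_same]
        · rw [Pi.single_eq_of_ne hk, add_zero]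
          exact h1 k
      · have : indicatorTop (C i) ((extChartAt 𝓘(ℝ, V i) (u i)).symm (z i + w)) = ⊤ := if_neg hw
        exact le_top.trans_eq this.symm

/-- The product of the Clarke tangent cones lies in the Clarke tangent cone of the product. -/
theorem mem_clarkeTangentCone_pi [∀ i, FiniteDimensional ℝ (V i)]
    [∀ i, T2Space (U i)] [∀ i, IsManifold 𝓘(ℝ, V i) ∞ (U i)] [∀ i, IsManifold 𝓘(ℝ, V i) 1 (U i)]
    {C : ∀ i, Set (U i)} {u : ∀ i, U i} (hu : ∀ i, u i ∈ C i)
    {v : TangentSpace (piModel V) u}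
    (hv : ∀ i, component v i ∈ clarkeTangentCone 𝓘(ℝ, V i) (C i) (u i)) :
    v ∈ clarkeTangentCone (piModel V) {w : ∀ i, U i | ∀ i, w i ∈ C i} u := by
  classical
  intro p hp
  have h1 : (show (∀ i, V i) →L[ℝ] ℝ from p) (show ∀ i, V i from v) =
      ∑ i, (show (∀ i, V i) →L[ℝ] ℝ from p) (Pi.single i ((show ∀ i, V i from v) i)) := by
    rw [← map_sum, Finset.univ_sum_single]
  refine h1.trans_le (Finset.sum_nonpos fun i _ => ?_)
  exact hv i _ (comp_single_mem_limitingNormalCone hu hp i)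

end Product

/-! ### The Clarke tangent cone is a closed convex cone. -/

section TangentCone

variable {E : Type*} [NormedAddCommGroup E] [NormedSpace ℝ E]
  {H : Type*} [TopologicalSpace H] (I : ModelWithCorners ℝ E H)
  {M : Type*} [TopologicalSpace M] [ChartedSpace H M] [IsManifold I 1 M]

theorem isClosed_clarkeTangentCone (S : Set M) (s : M) :
    IsClosed (show Set E from clarkeTangentCone I S s) := by
  have : (show Set E from clarkeTangentCone I S s) =
      ⋂ p ∈ limitingNormalCone I S s, {v : E | (show E →L[ℝ] ℝ from p) v ≤ 0} := by
    ext v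
    rw [mem_iInter₂]
    rfl
  rw [this]
  exact isClosed_biInter fun p _ =>
    isClosed_le (show E →L[ℝ] ℝ from p).continuous continuous_const

theorem zero_mem_clarkeTangentCone (S : Set M) (s : M) : 0 ∈ clarkeTangentCone I S s :=
  fun p _ => (map_zero p).le

variable {I} in
theorem add_mem_clarkeTangentCone {S : Set M} {s : M} {v w : TangentSpace I s}
    (hv : v ∈ clarkeTangentCone I S s) (hw : w ∈ clarkeTangentCone I S s) :
    v + w ∈ clarkeTangentCone I S s :=
  fun p hp => (map_add p v w).trans_le (add_nonpos (hv p hp) (hw p hp))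

variable {I} in
theorem smul_mem_clarkeTangentCone {S : Set M} {s : M} {v : TangentSpace I s}
    (hv : v ∈ clarkeTangentCone I S s) {t : ℝ} (ht : 0 ≤ t) :
    t • v ∈ clarkeTangentCone I S s :=
  fun p hp => (map_smul p t v).trans_le (mul_nonpos_of_nonneg_of_nonpos ht (hv p hp))

end TangentCone

/-! ### Sublinearity of the product metric norm. -/

section Seminorm

theorem sqrt_bilin_add_le {X : Type*} [AddCommGroup X] [Module ℝ X] (B : X →ₗ[ℝ] X →ₗ[ℝ] ℝ)
    (hB : ∀ x y, B x y = B y x) (hpos : ∀ x, 0 ≤ B x x) (x y : X) :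
    √(B (x + y) (x + y)) ≤ √(B x x) + √(B y y) := by
  have hcs : B x y ≤ √(B x x) * √(B y y) := by
    rw [← Real.sqrt_mul (hpos x)]
    refine Real.le_sqrt_of_sq_le ?_
    have := LinearMap.BilinForm.apply_mul_apply_le_of_forall_zero_le B hpos x y
    rw [hB y x, ← sq] at this
    exact this
  refine Real.sqrt_le_iff.2 ⟨by positivity, ?_⟩
  rw [add_sq, Real.sq_sqrt (hpos x), Real.sq_sqrt (hpos y)]
  simp only [map_add, LinearMap.add_apply]
  rw [hB y x]
  linarith

variable {ι : Type*} [Fintype ι] {V : ι → Type*} [∀ i, NormedAddCommGroup (V i)]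
  [∀ i, NormedSpace ℝ (V i)]
  {U : ι → Type*} [∀ i, TopologicalSpace (U i)] [∀ i, ChartedSpace (V i) (U i)]
  [∀ i, IsManifold 𝓘(ℝ, V i) ∞ (U i)] (g : ∀ i, SmoothMetric (V i) (U i)) (u : ∀ i, U i)

/-- The metric tensor of a factor, on the model space. -/
def metricForm (i : ι) : V i →L[ℝ] V i →L[ℝ] ℝ := (g i).inner (u i)

/-- The product metric tensor, on the model space. -/
def productForm : (∀ i, V i) →ₗ[ℝ] (∀ i, V i) →ₗ[ℝ] ℝ :=
  LinearMap.mk₂ ℝ (fun v w => ∑ i, metricForm g u i (v i) (w i))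
    (fun _ _ _ => by simp [Finset.sum_add_distrib])
    (fun _ _ _ => by simp [Finset.mul_sum])
    (fun _ _ _ => by simp [Finset.sum_add_distrib])
    (fun _ _ _ => by simp [Finset.mul_sum])

theorem productForm_nonneg (v : ∀ i, V i) : 0 ≤ productForm g u v v := by
  refine Finset.sum_nonneg fun i _ => ?_
  rcases eq_or_ne (v i) 0 with h | h
  · simp [h]
  · exact ((g i).pos (u i) (v i) h).le

theorem productForm_symm (v w : ∀ i, V i) : productForm g u v w = productForm g u w v :=
  Finset.sum_congr rfl fun i _ => (g i).symm (u i) (v i) (w i)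

theorem continuous_productForm : Continuous fun v : ∀ i, V i => productForm g u v v := by
  change Continuous fun v : ∀ i, V i => ∑ i, metricForm g u i (v i) (v i)
  fun_prop

theorem productForm_smul (t : ℝ) (ht : 0 ≤ t) (v : ∀ i, V i) :
    √(productForm g u (t • v) (t • v)) = t * √(productForm g u v v) := by
  rw [map_smul, map_smul, LinearMap.smul_apply, smul_eq_mul, smul_eq_mul, ← mul_assoc,
    Real.sqrt_mul (mul_self_nonneg t), Real.sqrt_mul_self ht]

theorem productForm_single [DecidableEq ι] (i : ι) (v : V i) :
    √(productForm g u (Pi.single i v) (Pi.single i v)) =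
      metricNorm (g i) (show TangentSpace 𝓘(ℝ, V i) (u i) from v) := by
  have : productForm g u (Pi.single i v) (Pi.single i v) = metricForm g u i v v := by
    refine (Finset.sum_eq_single i (fun k _ hk => ?_) (by simp)).trans ?_
    · simp [Pi.single_eq_of_ne hk]
    · rw [Pi.single_eq_same]
  rw [this]
  rfl

end Seminorm

/-! ### Local Lipschitz calculus and slicing of real-valued functions. -/

section LipschitzNear

variable {Y Z : Type*} [NormedAddCommGroup Y] [NormedAddCommGroup Z]

/-- `f` is Lipschitz on a neighbourhood of `y`. -/
def IsLipschitzNear (f : Z → ℝ) (y : Z) : Prop :=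
  ∃ κ : NNReal, ∃ s ∈ 𝓝 y, LipschitzOnWith κ f s

theorem IsLipschitzNear.continuousAt {f : Z → ℝ} {y : Z} (h : IsLipschitzNear f y) :
    ContinuousAt f y := by
  obtain ⟨κ, s, hs, hf⟩ := h
  exact hf.continuousOn.continuousAt hs

theorem IsLipschitzNear.add {f g : Z → ℝ} {y : Z} (hf : IsLipschitzNear f y)
    (hg : IsLipschitzNear g y) : IsLipschitzNear (fun x => f x + g x) y := by
  obtain ⟨κ, s, hs, hf⟩ := hf
  obtain ⟨κ', s', hs', hg⟩ := hg
  exact ⟨κ + κ', s ∩ s', inter_mem hs hs',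
    (hf.mono inter_subset_left).add (hg.mono inter_subset_right)⟩

theorem IsLipschitzNear.sum {ι : Type*} (t : Finset ι) {f : ι → Z → ℝ} {y : Z}
    (hf : ∀ i, IsLipschitzNear (f i) y) : IsLipschitzNear (fun x => ∑ i ∈ t, f i x) y := by
  classical
  induction t using Finset.induction_on with
  | empty => exact ⟨0, univ, univ_mem, by simp [LipschitzWith.const']⟩
  | insert i t hi ih => simpa only [Finset.sum_insert hi] using (hf i).add ih

variable [NormedSpace ℝ Y] [NormedSpace ℝ Z]

theorem IsLipschitzNear.comp {f : Z → ℝ} {m : Y → Z} {y : Y} (h : IsLipschitzNear f (m y))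
    (hm : ContDiff ℝ 1 m) : IsLipschitzNear (fun x => f (m x)) y := by
  obtain ⟨κ, s, hs, hf⟩ := h
  obtain ⟨κ', s', hs', hm'⟩ := hm.contDiffAt.exists_lipschitzOnWith (x := y)
  exact ⟨κ * κ', s' ∩ m ⁻¹' s, inter_mem hs' (hm.continuous.continuousAt hs),
    hf.comp (hm'.mono inter_subset_left) fun x hx => hx.2⟩

/-- A lower bound for the lower Dini derivative along a curve is a lower bound along its tangent
line. -/
theorem IsLipschitzNear.eventually_le_of_liminf {f : Z → ℝ} {y a : Z} (hf : IsLipschitzNear f y)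
    {γ : ℝ → Z} (hγ0 : γ 0 = y) (hγ : HasDerivAt γ a 0) {m : ℝ}
    (hm : ((-m : ℝ) : EReal) ≤
      liminf (fun t : ℝ => (((f (γ t) - f y) / t : ℝ) : EReal)) (𝓝[>] 0))
    {ε : ℝ} (hε : 0 < ε) : ∀ᶠ t in 𝓝[>] (0 : ℝ), f y - t * (m + ε) ≤ f (y + t • a) := by
  obtain ⟨κ, s, hs, hf⟩ := hf
  have h1 : ∀ᶠ t in 𝓝[>] (0 : ℝ), ((-(m + ε / 2) : ℝ) : EReal) <
      (((f (γ t) - f y) / t : ℝ) : EReal) := by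
    refine eventually_lt_of_lt_liminf (lt_of_lt_of_le ?_ hm)
    exact EReal.coe_lt_coe_iff.2 (by linarith)
  have h2 : ∀ᶠ t in 𝓝 (0 : ℝ), γ t ∈ s := hγ.continuousAt (by rwa [hγ0])
  have h3 : ∀ᶠ t in 𝓝 (0 : ℝ), y + t • a ∈ s := by
    have hc : Continuous fun t : ℝ => y + t • a := by fun_prop
    exact hc.continuousAt (by simpa using hs)
  -- The curve and its tangent line differ by `o(t)`, so `f` differs by at most `ε t / 2`; `κ + 1`
  -- avoids division by zero.
  have h4 : ∀ᶠ t in 𝓝 (0 : ℝ), ‖γ t - y - t • a‖ ≤ ε / (2 * (κ + 1)) * ‖t‖ := by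
    have := (hasDerivAt_iff_isLittleO_nhds_zero.1 hγ).def
      (show 0 < ε / (2 * ((κ : ℝ) + 1)) by positivity)
    simpa [hγ0] using this
  filter_upwards [h1, h2.filter_mono nhdsWithin_le_nhds, h3.filter_mono nhdsWithin_le_nhds,
    h4.filter_mono nhdsWithin_le_nhds, self_mem_nhdsWithin] with t h1 h2 h3 h4 (ht : 0 < t)
  rw [EReal.coe_lt_coe_iff, lt_div_iff₀ ht] at h1
  have h5 := hf.dist_le_mul _ h2 _ h3
  rw [Real.dist_eq, dist_eq_norm, ← sub_sub] at h5
  rw [Real.norm_eq_abs, abs_of_pos ht] at h4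
  have h6 : (κ : ℝ) * ‖γ t - y - t • a‖ ≤ ε / 2 * t := by
    calc (κ : ℝ) * ‖γ t - y - t • a‖ ≤ (κ + 1) * (ε / (2 * (κ + 1)) * t) := by
          gcongr
          linarith
      _ = ε / 2 * t := by field_simp
  have h7 := (abs_le.1 h5).2
  nlinarith

theorem IsLimitingSubgradient.slice_real {f : Z → ℝ} {g : Y → ℝ} (j : Y →L[ℝ] Z) (pr : Z →L[ℝ] Y)
    {y : Z} {ξ : Z →L[ℝ] ℝ} (h : IsLimitingSubgradient (fun x => (f x : EReal)) y ξ)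
    (hg : ContinuousAt g (pr y)) (hslice : ∀ z, ∃ c : ℝ, ∀ w, f (z + j w) = g (pr z + w) + c) :
    IsLimitingSubgradient (fun x => (g x : EReal)) (pr y) (ξ.comp j) := by
  refine h.slice j pr (fun z hz _ => ?_) (Eventually.of_forall fun z _ => ?_)
  · exact (continuous_coe_real_ereal.tendsto _).comp
      (hg.tendsto.comp ((pr.continuous.tendsto y).comp hz))
  · obtain ⟨c, hc⟩ := hslice z
    refine ⟨c, ?_, Eventually.of_forall fun w => ?_⟩
    · have := hc 0
      rw [map_zero, add_zero, add_zero] at this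
      rw [this, EReal.coe_add]
    · rw [hc w, EReal.coe_add]

theorem sum_add_single {ι : Type*} [Fintype ι] [DecidableEq ι] {W : ι → Type*}
    [∀ i, AddCommGroup (W i)] (f : ∀ i, W i → ℝ) (z : ∀ i, W i) (i : ι) (w : W i) :
    ∑ k, f k ((z + Pi.single i w) k) = f i (z i + w) + ∑ k ∈ Finset.univ.erase i, f k (z k) := by
  rw [← Finset.add_sum_erase _ _ (Finset.mem_univ i)]
  congr 1
  · simp
  · refine Finset.sum_congr rfl fun k hk => ?_
    rw [Pi.add_apply, Pi.single_eq_of_ne (Finset.ne_of_mem_erase hk), add_zero]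

end LipschitzNear

/-! ### The control system in charts, and the costate identity. -/

section ControlSystem

variable {n : ℕ} {E : Type*} [NormedAddCommGroup E] [NormedSpace ℝ E]
  {Q : Type*} [TopologicalSpace Q] [ChartedSpace E Q]
  {V : Fin n → Type*} [∀ i, NormedAddCommGroup (V i)] [∀ i, NormedSpace ℝ (V i)]
  {U : Fin n → Type*} [∀ i, TopologicalSpace (U i)] [∀ i, ChartedSpace (V i) (U i)]
  (F : ∀ i, Q × U i → Q) (ℓ : Q → ℝ) (L : ∀ i, Q × U i → ℝ) (q₀ : Q) (u : ∀ i, U i)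

theorem stateSeq_castSucc_of_eq_zero {n : ℕ} {Q : Type*} {U : Fin n → Type*}
    (F : ∀ i, Q × U i → Q) (q₀ : Q) (u : ∀ i, U i) {i : Fin n} (hi : (i : ℕ) = 0) :
    stateSeq F q₀ u i.castSucc = q₀ := by
  have : i.castSucc = 0 := Fin.ext (by simpa using hi)
  rw [this]
  rfl

/-- The derivative of the state `q_j` with respect to the control sequence. -/
def stateLin (j : Fin (n + 1)) : (∀ i, V i) →L[ℝ] E :=
  Fin.induction (motive := fun _ => (∀ i, V i) →L[ℝ] E) 0
    (fun i D => (show E →L[ℝ] E from partialState F q₀ u i).comp D +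
      (show V i →L[ℝ] E from partialControl F q₀ u i).comp (ContinuousLinearMap.proj i)) j

theorem stateLin_succ (i : Fin n) (w : ∀ i, V i) :
    stateLin (E := E) F q₀ u i.succ w =
      (show E →L[ℝ] E from partialState F q₀ u i) (stateLin F q₀ u i.castSucc w) +
        (show V i →L[ℝ] E from partialControl F q₀ u i) (w i) := rfl

variable {F} in
theorem hasCurveDeriv_stateSeq
    (hF : ∀ i, ContMDiff (𝓘(ℝ, E).prod 𝓘(ℝ, V i)) 𝓘(ℝ, E) 1 (F i)) {c : ℝ → ∀ i, U i}
    {w : ∀ i, V i} (hc : HasCurveDeriv (piModel V) c u w) (j : Fin (n + 1)) :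
    HasCurveDeriv 𝓘(ℝ, E) (fun t => stateSeq F q₀ (c t) j) (stateSeq F q₀ u j)
      (stateLin F q₀ u j w) := by
  induction j using Fin.induction with
  | zero => exact ⟨rfl, continuousAt_const,
      hasDerivAt_const (0 : ℝ) (extChartAt 𝓘(ℝ, E) q₀ q₀)⟩
  | succ i ih => exact ih.comp₂ ((hF i).mdifferentiable one_ne_zero _) (hc.apply i)

variable (V) in
/-- The model space for the final state and the pairs of states and controls at each stage. -/
abbrev StageSpace (E : Type*) : Type _ := E × ∀ i, E × V i

/-- The running cost of stage `i` in charts. At the first stage the state is frozen. -/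
def chartRunningCost (i : Fin n) (z : E × V i) : ℝ :=
  L i (if (i : ℕ) = 0 then q₀ else
    (extChartAt 𝓘(ℝ, E) (stateSeq F q₀ u i.castSucc)).symm z.1,
    (extChartAt 𝓘(ℝ, V i) (u i)).symm z.2)

/-- The cost in charts, as a function of unconstrained states and controls. -/
def chartCost (z : StageSpace V E) : ℝ :=
  ℓ ((extChartAt 𝓘(ℝ, E) (stateSeq F q₀ u (Fin.last n))).symm z.1) +
    ∑ i, chartRunningCost F L q₀ u i (z.2 i)

/-- The states along the control sequence `w`, in the charts around those along `u`. -/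
def chartPoint (w : ∀ i, U i) : StageSpace V E :=
  (extChartAt 𝓘(ℝ, E) (stateSeq F q₀ u (Fin.last n)) (stateSeq F q₀ w (Fin.last n)),
    fun i => (extChartAt 𝓘(ℝ, E) (stateSeq F q₀ u i.castSucc) (stateSeq F q₀ w i.castSucc),
      extChartAt 𝓘(ℝ, V i) (u i) (w i)))

/-- The derivative of `chartPoint`. -/
def stageLin : (∀ i, V i) →L[ℝ] StageSpace V E :=
  (stateLin F q₀ u (Fin.last n)).prod (ContinuousLinearMap.pi fun i =>
    (stateLin F q₀ u i.castSucc).prod (ContinuousLinearMap.proj i))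

variable {F L ℓ}

theorem chartRunningCost_of_ne_zero {i : Fin n} (hi : (i : ℕ) ≠ 0) :
    chartRunningCost (E := E) (V := V) F L q₀ u i = L i ∘
      (extChartAt (𝓘(ℝ, E).prod 𝓘(ℝ, V i)) (stateSeq F q₀ u i.castSucc, u i)).symm := by
  ext z
  rw [extChartAt_prod]
  simp only [chartRunningCost, if_neg hi]
  rfl

theorem isLipschitzNear_chartRunningCost [∀ i, IsManifold 𝓘(ℝ, V i) ∞ (U i)]
    [IsManifold 𝓘(ℝ, E) ∞ Q]
    (hL : ∀ i, IsLocallyLipschitz (𝓘(ℝ, E).prod 𝓘(ℝ, V i)) (L i)) (i : Fin n) :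
    IsLipschitzNear (chartRunningCost (E := E) (V := V) F L q₀ u i)
      (extChartAt 𝓘(ℝ, E) (stateSeq F q₀ u i.castSucc) (stateSeq F q₀ u i.castSucc),
        extChartAt 𝓘(ℝ, V i) (u i) (u i)) := by
  have h : IsLipschitzNear _ _ :=
    (hL i).exists_lipschitzOnWith (stateSeq F q₀ u i.castSucc, u i)
  by_cases hi : (i : ℕ) = 0
  -- At the first stage the state is frozen: compose with the map that resets the first coordinate
  -- to that of `q₀`.
  · have h1 := h.comp (y := (extChartAt 𝓘(ℝ, E) (stateSeq F q₀ u i.castSucc)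
      (stateSeq F q₀ u i.castSucc), extChartAt 𝓘(ℝ, V i) (u i) (u i)))
      (m := fun z : E × V i => (extChartAt 𝓘(ℝ, E) (stateSeq F q₀ u i.castSucc)
        (stateSeq F q₀ u i.castSucc), z.2)) (by fun_prop)
    convert h1 using 1
    ext z
    rw [extChartAt_prod]
    simp only [chartRunningCost, if_pos hi]
    change _ = L i ((extChartAt 𝓘(ℝ, E) (stateSeq F q₀ u i.castSucc)).symm
      (extChartAt 𝓘(ℝ, E) (stateSeq F q₀ u i.castSucc) (stateSeq F q₀ u i.castSucc)),
      (extChartAt 𝓘(ℝ, V i) (u i)).symm z.2)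
    rw [extChartAt_to_inv, stateSeq_castSucc_of_eq_zero F q₀ u hi]
  · rw [chartRunningCost_of_ne_zero q₀ u hi]
    exact h

theorem isLipschitzNear_chartCost [∀ i, IsManifold 𝓘(ℝ, V i) ∞ (U i)] [IsManifold 𝓘(ℝ, E) ∞ Q]
    (hℓ : IsLocallyLipschitz 𝓘(ℝ, E) ℓ)
    (hL : ∀ i, IsLocallyLipschitz (𝓘(ℝ, E).prod 𝓘(ℝ, V i)) (L i)) :
    IsLipschitzNear (chartCost (E := E) (V := V) F ℓ L q₀ u) (chartPoint F q₀ u u) := by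
  have h1 : IsLipschitzNear _ _ := hℓ.exists_lipschitzOnWith (stateSeq F q₀ u (Fin.last n))
  refine IsLipschitzNear.add ?_ (IsLipschitzNear.sum _ fun i => ?_)
  · exact h1.comp (y := chartPoint (E := E) (V := V) F q₀ u u)
      (m := fun z : StageSpace V E => z.1) (by fun_prop)
  · exact (isLipschitzNear_chartRunningCost q₀ u hL i).comp
      (y := chartPoint (E := E) (V := V) F q₀ u u)
      (m := fun z : StageSpace V E => z.2 i)
      ((ContinuousLinearMap.proj (R := ℝ) (φ := fun k => E × V k) i).comp
        (ContinuousLinearMap.snd ℝ E (∀ k, E × V k))).contDiff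

theorem chartCost_chartPoint {w : ∀ i, U i}
    (hq : ∀ j, stateSeq F q₀ w j ∈ (extChartAt 𝓘(ℝ, E) (stateSeq F q₀ u j)).source)
    (hw : ∀ i, w i ∈ (extChartAt 𝓘(ℝ, V i) (u i)).source) :
    chartCost (E := E) (V := V) F ℓ L q₀ u (chartPoint F q₀ u w) = cost F ℓ L q₀ w := by
  unfold chartCost cost chartPoint
  refine congrArg₂ (· + ·) ?_ (Finset.sum_congr rfl fun i _ => ?_)
  · exact congrArg ℓ ((extChartAt 𝓘(ℝ, E) (stateSeq F q₀ u (Fin.last n))).left_inv (hq _))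
  · unfold chartRunningCost
    by_cases hi : (i : ℕ) = 0
    · simp only [if_pos hi, (extChartAt 𝓘(ℝ, V i) (u i)).left_inv (hw i),
        stateSeq_castSucc_of_eq_zero F q₀ w hi]
    · simp only [if_neg hi, (extChartAt 𝓘(ℝ, V i) (u i)).left_inv (hw i),
        (extChartAt 𝓘(ℝ, E) (stateSeq F q₀ u i.castSucc)).left_inv (hq _)]

/-- The directional form of criticality, in charts. -/
theorem IsCritical.eventually_chartCost_le [IsManifold 𝓘(ℝ, E) ∞ Q]
    [∀ i, IsManifold 𝓘(ℝ, V i) ∞ (U i)] [∀ i, FiniteDimensional ℝ (V i)] [∀ i, T2Space (U i)]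
    {g : ∀ i, SmoothMetric (V i) (U i)} {C : ∀ i, Set (U i)}
    (hF : ∀ i, ContMDiff (𝓘(ℝ, E).prod 𝓘(ℝ, V i)) 𝓘(ℝ, E) 1 (F i))
    (hℓ : IsLocallyLipschitz 𝓘(ℝ, E) ℓ)
    (hL : ∀ i, IsLocallyLipschitz (𝓘(ℝ, E).prod 𝓘(ℝ, V i)) (L i))
    {u : ∀ i, U i} (hu : ∀ i, u i ∈ C i) {Δ : ℝ} (hcrit : IsCritical g C (cost F ℓ L q₀) Δ u)
    {w : ∀ i, V i} (hw : ∀ i, w i ∈ clarkeTangentCone 𝓘(ℝ, V i) (C i) (u i))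
    {ε : ℝ} (hε : 0 < ε) :
    ∀ᶠ t in 𝓝[>] (0 : ℝ),
      chartCost (E := E) (V := V) F ℓ L q₀ u (chartPoint (E := E) (V := V) F q₀ u u) -
          t * (Δ * √(productForm g u w w) + ε) ≤
        chartCost (E := E) (V := V) F ℓ L q₀ u (chartPoint (E := E) (V := V) F q₀ u u + t • stageLin (E := E) F q₀ u w) := by
  obtain ⟨c, hcs, hc⟩ := exists_smooth_curve (I := piModel V) u w
  have hq := hasCurveDeriv_stateSeq (u := u) q₀ hF hc
  have hev : ∀ᶠ t in 𝓝 (0 : ℝ),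
      chartCost (E := E) (V := V) F ℓ L q₀ u (chartPoint (E := E) (V := V) F q₀ u (c t)) = cost F ℓ L q₀ (c t) := by
    have h1 : ∀ᶠ t in 𝓝 (0 : ℝ), ∀ j,
        stateSeq F q₀ (c t) j ∈ (extChartAt 𝓘(ℝ, E) (stateSeq F q₀ u j)).source :=
      eventually_all.2 fun j => (hq j).2.1 (by
        rw [(hq j).1]; exact extChartAt_source_mem_nhds _)
    have h2 : ∀ᶠ t in 𝓝 (0 : ℝ), ∀ i, c t i ∈ (extChartAt 𝓘(ℝ, V i) (u i)).source :=
      eventually_all.2 fun i => (hc.apply i).2.1 (by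
        rw [(hc.apply i).1]; exact extChartAt_source_mem_nhds _)
    filter_upwards [h1, h2] with t h1 h2 using chartCost_chartPoint q₀ u h1 h2
  have hbase : chartCost (E := E) (V := V) F ℓ L q₀ u (chartPoint (E := E) (V := V) F q₀ u u) = cost F ℓ L q₀ u :=
    chartCost_chartPoint q₀ u (fun _ => mem_extChartAt_source _) fun _ => mem_extChartAt_source _
  refine (isLipschitzNear_chartCost q₀ u hℓ hL).eventually_le_of_liminf
    (γ := fun t => chartPoint (E := E) (V := V) F q₀ u (c t)) ?_ ?_ ?_ hε
  · exact congrArg (chartPoint (E := E) (V := V) F q₀ u) hc.1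
  · exact (hq (Fin.last n)).2.2.prodMk (hasDerivAt_pi.2 fun i =>
      (hq i.castSucc).2.2.prodMk (hc.apply i).2.2)
  · have h1 := hcrit.2 (show TangentSpace (piModel V) u from w) (mem_clarkeTangentCone_pi hu hw)
    -- The Dini derivative is an infimum over curves, so criticality bounds the lower limit along
    -- the chosen `c`.
    refine (h1.trans (iInf₂_le c (hc.isSmoothCurveThrough hcs))).trans_eq (liminf_congr ?_)
    filter_upwards [hev.filter_mono nhdsWithin_le_nhds] with t ht
    rw [ht, hbase]

/-- The costate recursion solved backwards, applied to the variation of the states. -/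
theorem sum_costate {n : ℕ} {E : Type*} [NormedAddCommGroup E] [NormedSpace ℝ E]
    (a p : Fin (n + 1) → E →L[ℝ] ℝ) (A : Fin n → E →L[ℝ] E) (e : Fin n → E) (δ : Fin (n + 1) → E)
    (hδ0 : δ 0 = 0) (hδ : ∀ i, δ i.succ = A i (δ i.castSucc) + e i)
    (hp : -p (Fin.last n) = a (Fin.last n))
    (hpi : ∀ i : Fin n, p i.castSucc = -a i.castSucc + (p i.succ).comp (A i)) :
    a (Fin.last n) (δ (Fin.last n)) + ∑ i : Fin n, a i.castSucc (δ i.castSucc) =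
      -∑ i : Fin n, p i.succ (e i) := by
  have h1 : ∀ i : Fin n, a i.castSucc (δ i.castSucc) =
      p i.succ (δ i.succ) - p i.castSucc (δ i.castSucc) - p i.succ (e i) := fun i => by
    rw [hpi i, hδ i]
    simp only [map_add, add_apply, neg_apply,
      ContinuousLinearMap.comp_apply]
    ring
  -- Splitting off the first or the last term of `∑ p_j δ_j` telescopes the differences in `h1`; the
  -- boundary term at `0` vanishes because `δ 0 = 0`.
  have h2 := (Fin.sum_univ_succ fun j => p j (δ j)).symm.trans
    (Fin.sum_univ_castSucc fun j => p j (δ j))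
  simp only [h1, Finset.sum_sub_distrib, ← hp, hδ0, map_zero, neg_apply] at h2 ⊢
  linarith

end ControlSystem

end GeometricControl

end

/-! ### The necessary conditions. -/

open GeometricControl in
/-- Necessary conditions for a `Δ`-critical control sequence. The families `a` and `p` are indexed by
`0, …, n` for convenience; for `1 ≤ n` their entries at the index `0` are subject to no condition. -/
theorem mainTheorem1 {n : ℕ}
    {E : Type*} [NormedAddCommGroup E] [NormedSpace ℝ E] [FiniteDimensional ℝ E]
    {Q : Type*} [TopologicalSpace Q] [T2Space Q] [ChartedSpace E Q] [IsManifold 𝓘(ℝ, E) ∞ Q]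
    {V : Fin n → Type*} [∀ i, NormedAddCommGroup (V i)] [∀ i, NormedSpace ℝ (V i)]
    [∀ i, FiniteDimensional ℝ (V i)]
    {U : Fin n → Type*} [∀ i, TopologicalSpace (U i)] [∀ i, T2Space (U i)]
    [∀ i, ChartedSpace (V i) (U i)] [∀ i, IsManifold 𝓘(ℝ, V i) ∞ (U i)]
    (g : ∀ i, GeometricControl.SmoothMetric (V i) (U i))
    (C : ∀ i, Set (U i)) (hC : ∀ i, IsClosed (C i))
    (F : ∀ i, Q × U i → Q)
    (hF : ∀ i, ContMDiff (𝓘(ℝ, E).prod 𝓘(ℝ, V i)) 𝓘(ℝ, E) 1 (F i))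
    (ℓ : Q → ℝ) (hℓ : GeometricControl.IsLocallyLipschitz 𝓘(ℝ, E) ℓ)
    (L : ∀ i, Q × U i → ℝ)
    (hL : ∀ i, GeometricControl.IsLocallyLipschitz (𝓘(ℝ, E).prod 𝓘(ℝ, V i)) (L i))
    (q₀ : Q) (u : ∀ i, U i) (hu : ∀ i, u i ∈ C i) (Δ : ℝ)
    (hcrit : GeometricControl.IsCritical g C (GeometricControl.cost F ℓ L q₀) Δ u) :
    ∃ (a p : ∀ j : Fin (n + 1),
          GeometricControl.Cotangent 𝓘(ℝ, E) (GeometricControl.stateSeq F q₀ u j))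
      (b : ∀ i : Fin n, GeometricControl.Cotangent 𝓘(ℝ, V i) (u i)),
      a (Fin.last n) ∈ GeometricControl.limitingSubdiff 𝓘(ℝ, E) (fun x : Q => (ℓ x : EReal))
        (GeometricControl.stateSeq F q₀ u (Fin.last n)) ∧
      (∀ i : Fin n, (i : ℕ) = 0 →
        b i ∈ GeometricControl.limitingSubdiff 𝓘(ℝ, V i) (fun c : U i => (L i (q₀, c) : EReal))
          (u i)) ∧
      (∀ i : Fin n, 1 ≤ (i : ℕ) →
        GeometricControl.prodCovector (a i.castSucc) (b i) ∈
          GeometricControl.limitingSubdiff (𝓘(ℝ, E).prod 𝓘(ℝ, V i))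
            (fun x : Q × U i => (L i x : EReal))
            (GeometricControl.stateSeq F q₀ u i.castSucc, u i)) ∧
      -p (Fin.last n) = a (Fin.last n) ∧
      (∀ i : Fin n, 1 ≤ (i : ℕ) →
        p i.castSucc =
          -a i.castSucc + (p i.succ).comp (GeometricControl.partialState F q₀ u i)) ∧
      ∀ i : Fin n, ∀ v ∈ GeometricControl.clarkeTangentCone 𝓘(ℝ, V i) (C i) (u i),
        -(Δ * GeometricControl.metricNorm (g i) v) ≤
          b i v - p i.succ (GeometricControl.partialControl F q₀ u i v) := by
  classical
  have hQ1 : IsManifold 𝓘(ℝ, E) 1 Q := IsManifold.of_le (n := ∞) (by simp)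
  have hU1 : ∀ i, IsManifold 𝓘(ℝ, V i) 1 (U i) := fun i => IsManifold.of_le (n := ∞) (by simp)
  obtain ⟨κ, s, hs, hlip⟩ := isLipschitzNear_chartCost (F := F) q₀ u hℓ hL
  let T : ∀ i, Set (V i) := fun i => clarkeTangentCone 𝓘(ℝ, V i) (C i) (u i)
  let K : Set (∀ i, V i) := {w | ∀ i, w i ∈ T i}
  have hK : IsClosed K := by
    have : K = ⋂ i, (fun w : ∀ i, V i => w i) ⁻¹' T i := by
      ext w
      rw [mem_iInter]
      rfl
    rw [this]
    exact isClosed_iInter fun i =>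
      (isClosed_clarkeTangentCone 𝓘(ℝ, V i) (C i) (u i)).preimage (continuous_apply i)
  obtain ⟨ξ, hξ, hξK⟩ := exists_limitingSubgradient_of_directional
    (ψ := fun w => Δ * √(productForm g u w w)) hs hlip (stageLin F q₀ u) hK
    (fun i => zero_mem_clarkeTangentCone 𝓘(ℝ, V i) (C i) (u i))
    (fun v hv w hw i => add_mem_clarkeTangentCone (hv i) (hw i))
    (fun v hv t ht i => smul_mem_clarkeTangentCone (hv i) ht)
    (continuous_const.mul (continuous_productForm g u).sqrt)
    (fun v w => by
      -- Subadditivity of `ψ` uses `0 ≤ Δ`.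
      rw [← mul_add]
      exact mul_le_mul_of_nonneg_left (sqrt_bilin_add_le _ (productForm_symm g u)
        (productForm_nonneg g u) v w) hcrit.1)
    (fun t v ht => by
      rw [productForm_smul g u t ht]
      ring)
    (fun w hw ε hε => hcrit.eventually_chartCost_le q₀ hF hℓ hL hu hw hε)
  let stage : ∀ i, E × V i →L[ℝ] StageSpace V E := fun i =>
    (ContinuousLinearMap.inr ℝ E (∀ k, E × V k)).comp
      (ContinuousLinearMap.single ℝ (fun k => E × V k) i)
  let prStage : ∀ i, StageSpace V E →L[ℝ] E × V i := fun i =>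
    (ContinuousLinearMap.proj (R := ℝ) (φ := fun k => E × V k) i).comp
      (ContinuousLinearMap.snd ℝ E (∀ k, E × V k))
  let a' : Fin (n + 1) → E →L[ℝ] ℝ := Fin.lastCases
    (ξ.comp (ContinuousLinearMap.inl ℝ E (∀ k, E × V k)))
    fun i => (ξ.comp (stage i)).comp (ContinuousLinearMap.inl ℝ E (V i))
  have ha_last : a' (Fin.last n) = ξ.comp (ContinuousLinearMap.inl ℝ E (∀ k, E × V k)) :=
    Fin.lastCases_last
  have ha : ∀ i : Fin n, a' i.castSucc =
      (ξ.comp (stage i)).comp (ContinuousLinearMap.inl ℝ E (V i)) := fun i =>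
    Fin.lastCases_castSucc i
  let b' : ∀ i, V i →L[ℝ] ℝ := fun i =>
    (ξ.comp (stage i)).comp (ContinuousLinearMap.inr ℝ E (V i))
  let A : Fin n → E →L[ℝ] E := fun i => partialState F q₀ u i
  -- The recursion is run down to index `0`, one step beyond what is required, so that `sum_costate`
  -- applies; that extra entry multiplies the zero variation of `q₀`.
  let p' : Fin (n + 1) → E →L[ℝ] ℝ := Fin.reverseInduction (-a' (Fin.last n))
    fun i P => -a' i.castSucc + P.comp (A i)
  have hp_last : p' (Fin.last n) = -a' (Fin.last n) := Fin.reverseInduction_last ..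
  have hp : ∀ i : Fin n, p' i.castSucc = -a' i.castSucc + (p' i.succ).comp (A i) := fun i =>
    Fin.reverseInduction_castSucc ..
  -- Separability: varying block `i` changes only the running cost of stage `i`.
  have hslice : ∀ (i : Fin n) (z : StageSpace V E), ∃ c : ℝ, ∀ w,
      chartCost F ℓ L q₀ u (z + stage i w) = chartRunningCost F L q₀ u i (prStage i z + w) + c := by
    intro i z
    refine ⟨ℓ ((extChartAt 𝓘(ℝ, E) (stateSeq F q₀ u (Fin.last n))).symm z.1) +
      ∑ k ∈ Finset.univ.erase i, chartRunningCost F L q₀ u k (z.2 k), fun w => ?_⟩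
    have h1 : (z + stage i w).1 = z.1 := add_zero z.1
    have h2 : (z + stage i w).2 = z.2 + Pi.single i w := rfl
    unfold chartCost
    rw [h1, h2, sum_add_single (fun k => chartRunningCost F L q₀ u k) z.2 i w]
    change _ + (chartRunningCost F L q₀ u i (z.2 i + w) + _) =
      chartRunningCost F L q₀ u i (z.2 i + w) + _
    ring
  let B : ∀ i, V i →L[ℝ] E := fun i => partialControl F q₀ u i
  have hsum : ∀ w : ∀ i, V i, ξ (stageLin F q₀ u w) =
      ∑ k, (b' k (w k) - p' k.succ (B k (w k))) := by
    intro w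
    have h1 := sum_costate a' p' A (fun k => B k (w k)) (fun j => stateLin F q₀ u j w) rfl
      (fun k => stateLin_succ F q₀ u k w) (by rw [hp_last, neg_neg]) hp
    have h2 : stageLin F q₀ u w = (stateLin F q₀ u (Fin.last n) w, 0) +
        ∑ k, stage k (stateLin F q₀ u k.castSucc w, w k) := by
      simp only [stage, ContinuousLinearMap.comp_apply, ← map_sum]
      refine Prod.ext (by simp [stageLin, Prod.fst_sum]) ?_
      simp only [ContinuousLinearMap.inr_apply, Prod.mk_add_mk, zero_add]
      exact (Finset.univ_sum_single fun k : Fin n => (stateLin F q₀ u k.castSucc w, w k)).symm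
    have h3 : ∀ k, ξ (stage k (stateLin F q₀ u k.castSucc w, w k)) =
        a' k.castSucc (stateLin F q₀ u k.castSucc w) + b' k (w k) := fun k => by
      rw [ha k]
      simp only [b', ContinuousLinearMap.comp_apply, ← map_add]
      simp
    have h4 : ξ (stateLin F q₀ u (Fin.last n) w, 0) =
        a' (Fin.last n) (stateLin F q₀ u (Fin.last n) w) := by
      rw [ha_last]
      rfl
    rw [h2, map_add, map_sum, h4, Finset.sum_congr rfl fun k _ => h3 k, Finset.sum_add_distrib,
      Finset.sum_sub_distrib, ← add_assoc, h1]
    ring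
  have hfinal : ∀ i, ∀ v ∈ T i, -(Δ * metricNorm (g i) (u := u i) v) ≤
      b' i v - p' i.succ (B i v) := by
    intro i v hv
    -- A variation of one control alone is admissible since every tangent cone contains `0`; its
    -- product norm is the norm of `g i`.
    have hmem : Pi.single i v ∈ K := fun k => by
      rcases eq_or_ne k i with rfl | hk
      · rwa [Pi.single_eq_same]
      · rw [Pi.single_eq_of_ne hk]
        exact zero_mem_clarkeTangentCone 𝓘(ℝ, V k) (C k) (u k)
    have h1 := hξK _ hmem
    simp only [productForm_single, hsum] at h1
    rw [Finset.sum_eq_single i (fun k _ hk => by simp [Pi.single_eq_of_ne hk]) (by simp),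
      Pi.single_eq_same] at h1
    linarith
  refine ⟨a', p', b', ?_, fun i hi => ?_, fun i hi => ?_, ?_, fun i _ => hp i, fun i v hv => ?_⟩
  · refine mem_limitingSubdiff_iff.2 ?_
    have h := hξ.slice_real (ContinuousLinearMap.inl ℝ E (∀ k, E × V k))
      (ContinuousLinearMap.fst ℝ E (∀ k, E × V k))
      (g := fun x => ℓ ((extChartAt 𝓘(ℝ, E) (stateSeq F q₀ u (Fin.last n))).symm x))
      (show IsLipschitzNear _ _ from hℓ.exists_lipschitzOnWith _).continuousAt fun z =>
        ⟨∑ k, chartRunningCost F L q₀ u k (z.2 k), fun w => by simp [chartCost]⟩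
    rw [← ha_last] at h
    exact h
  · refine mem_limitingSubdiff_iff.2 ?_
    have hc := (isLipschitzNear_chartRunningCost (F := F) q₀ u hL i).continuousAt
    -- Slicing in the control only: the frozen state makes the slice exactly `L i (q₀, ·)`, whatever
    -- the state coordinate of `z`.
    refine hξ.slice_real ((stage i).comp (ContinuousLinearMap.inr ℝ E (V i)))
      ((ContinuousLinearMap.snd ℝ E (V i)).comp (prStage i))
      (g := fun x => L i (q₀, (extChartAt 𝓘(ℝ, V i) (u i)).symm x)) ?_ fun z => ?_
    · have h1 : ∀ x : V i, L i (q₀, (extChartAt 𝓘(ℝ, V i) (u i)).symm x) =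
          chartRunningCost F L q₀ u i (extChartAt 𝓘(ℝ, E) (stateSeq F q₀ u i.castSucc)
            (stateSeq F q₀ u i.castSucc), x) := fun x => by
        simp only [chartRunningCost, if_pos hi]
      simp only [h1]
      have hx : Continuous fun x : V i => (extChartAt 𝓘(ℝ, E) (stateSeq F q₀ u i.castSucc)
        (stateSeq F q₀ u i.castSucc), x) := by fun_prop
      exact hc.tendsto.comp (hx.tendsto (extChartAt 𝓘(ℝ, V i) (u i) (u i)))
    · obtain ⟨c, hc⟩ := hslice i z
      refine ⟨c, fun w => (hc (0, w)).trans ?_⟩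
      simp only [chartRunningCost, if_pos hi]
      rfl
  · refine mem_limitingSubdiff_iff.2 ?_
    have h := hξ.slice_real (stage i) (prStage i)
      (isLipschitzNear_chartRunningCost q₀ u hL i).continuousAt (hslice i)
    rw [chartRunningCost_of_ne_zero q₀ u (by omega)] at h
    have hcov : ξ.comp (stage i) = ContinuousLinearMap.coprod (a' i.castSucc) (b' i) := by
      rw [ha i]
      ext x <;> simp [b']
    rw [hcov] at h
    exact h
  · exact (congrArg Neg.neg hp_last).trans (neg_neg _)
  · exact hfinal i v hv
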